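/- **Setting.** Let $m\ge 1$, let $R$ be a metric space, and write $\mathbb N^*=\{1,2,\dots\}$. For $T\in[0,1[$ let $\rho(T)$ be the unique $s>0$ with $\big(\tfrac{s}{1-T}\big)^{1-T}\big(\tfrac{s+2}{1+T}\big)^{1+T}=1$, and let $r(T)=1+\rho(T)$. For a finite set $J$ let $H(\mathbb C^J)$ be the space of entire functions on $\mathbb C^J$ with the topology of uniform convergence on compact sets. For $T=(T_1,\dots,T_m)\in[0,1[^m$, a continuous function $\phi:\mathbb R^m\times R\to\mathbb C$ is called *$T$-predictable* if for each pair of disjoint subsets $J^-,J^+$ of $\{1,\dots,m\}$ with $J=J^-\cup J^+\neq\emptyset$ and $J'=\{1,\dots,m\}\setminus J$ there is a continuous map $(\alpha,x)\in\mathbb R^{J'}\times R\mapsto F_{\alpha,x}\in H(\mathbb C^J)$ (depending on $(J^-,J^+)$) such that $\phi(a,x)=F_{a_{J'},x}(a_J)$ for all $(a,x)\in\mathbb R^m\times R$ with $a_j\le -T_j$ for $j\in J^-$ and $a_j\ge T_j$ for $j\in J^+$. Here $a_J=(a_j)_{j\in J}$ and $a_{J'}=(a_j)_{j\in J'}$.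 For $N\in(\mathbb N^*)^m$ and $\nu\in\mathbb N^m$ write $\nu\prec N$ if $\nu_j\le N_j$ for all $j$, and put $$w_{N,\nu}(a)=\prod_{j=1}^m\binom{N_j}{\nu_j}\Big(\frac{1-a_j}{2}\Big)^{\nu_j}\Big(\frac{1+a_j}{2}\Big)^{N_j-\nu_j},\qquad y_{N,\nu}=\Big(1-2\frac{\nu_j}{N_j}\Big)_{1\le j\le m}.$$ For $n\in\mathbb Z$ put $\rho^n\cdot a=(\rho_1^na_1,\dots,\rho_m^na_m)$. **Theorem 4.5.** Let $T\in[0,1[^m$, let $\phi$ be $T$-predictable, let $1<\rho_j<r(T_j)$ for $j=1,\dots,m$, and let $k\in\mathbb N$ ($k\ge0$). Then $$\phi(a,x)=\lim_{\min N_k\to\infty}\cdots\lim_{\min N_1\to\infty}\ \lim_{\min N_0\to\infty}\ \sum_{\nu_k\prec N_k}\cdots\sum_{\nu_0\prec N_0} w_{N_k,\nu_k}(\rho^{-k}\cdot a)\ \prod_{\kappa=0}^{k-1}w_{N_\kappa,\nu_\kappa}\big(\rho\cdot y_{N_{\kappa+1},\nu_{\kappa+1}}\big)\ \phi\big(y_{N_0,\nu_0},x\big),$$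 where the limit in $N_0\in(\mathbb N^*)^m$ is taken first and the limit in $N_k\in(\mathbb N^*)^m$ last. Each of these $k+1$ limits (for all fixed values of the remaining $N_\kappa$) is uniform in $(a,x)$ on every compact subset of $\big(\prod_{j=1}^m\,]-\rho_j^k r(T_j),\rho_j^k r(T_j)[\,\big)\times R$. Moreover, $\phi$ satisfies the Bernstein $\rho$-pseudo-autosimilarity relation $$\phi(a,x)=\lim_{\min N\to\infty}\ \sum_{\nu\prec N}w_{N,\nu}(\rho^{-k}\cdot a)\ \phi\big(\rho^k\cdot y_{N,\nu},x\big)$$ uniformly in $(a,x)$ on every compact subset of the same set. -/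

import Mathlib

open Filter Topology

namespace Supershift

/-- The function `s ↦ (s/(1-T))^(1-T) ((s+2)/(1+T))^(1+T)`, whose value is `1` exactly when the
real point `-1-s` (`s > 0`) lies on the lemniscate `Γ_T`. -/
noncomputable def lemniscateFun (T s : ℝ) : ℝ :=
  (s / (1 - T)) ^ (1 - T) * ((s + 2) / (1 + T)) ^ (1 + T)

/-- `r(T) = 1 + ρ(T)`, where `ρ(T)` is the root in `]0,∞[` of `lemniscateFun T s = 1`. For
`T ∈ [0,1[` the set below is a singleton, see `existsUnique_root`. -/
noncomputable def lemniscateRadius (T : ℝ) : ℝ :=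
  1 + sInf {s : ℝ | 0 < s ∧ lemniscateFun T s = 1}

theorem existsUnique_root {T : ℝ} (hT : T ∈ Set.Ico (0 : ℝ) 1) :
    ∃! s : ℝ, 0 < s ∧ lemniscateFun T s = 1 := by
  obtain ⟨h0, h1⟩ := hT
  have hm : 0 < 1 - T := by linarith
  have hp : 0 < 1 + T := by linarith
  have hmono : StrictMonoOn (lemniscateFun T) (Set.Ioi 0) := by
    intro s hs t _ hst
    have hs' : 0 < s := hs
    unfold lemniscateFun
    have a1 : (s / (1 - T)) ^ (1 - T) < (t / (1 - T)) ^ (1 - T) :=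
      Real.rpow_lt_rpow (by positivity) (by gcongr) hm
    have a2 : ((s + 2) / (1 + T)) ^ (1 + T) < ((t + 2) / (1 + T)) ^ (1 + T) :=
      Real.rpow_lt_rpow (by positivity) (by gcongr) hp
    exact mul_lt_mul'' a1 a2 (by positivity) (by positivity)
  have hcont : Continuous (lemniscateFun T) := by
    unfold lemniscateFun
    exact ((continuous_id.div_const _).rpow_const fun _ => Or.inr hm.le).mul
      (((continuous_id.add continuous_const).div_const _).rpow_const fun _ => Or.inr hp.le)
  have hz : lemniscateFun T 0 = 0 := by
    unfold lemniscateFun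
    rw [zero_div, Real.zero_rpow hm.ne', zero_mul]
  have h2 : 1 ≤ lemniscateFun T 2 := by
    unfold lemniscateFun
    have a1 : 1 ≤ (2 / (1 - T)) ^ (1 - T) :=
      Real.one_le_rpow (by rw [le_div_iff₀ hm]; linarith) hm.le
    have a2 : 1 ≤ (((2 : ℝ) + 2) / (1 + T)) ^ (1 + T) :=
      Real.one_le_rpow (by rw [le_div_iff₀ hp]; linarith) hp.le
    exact one_le_mul_of_one_le_of_one_le a1 a2
  obtain ⟨s, ⟨hs0, _⟩, hs⟩ := intermediate_value_Icc (show (0 : ℝ) ≤ 2 by norm_num)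
    hcont.continuousOn (show (1 : ℝ) ∈ Set.Icc _ _ from ⟨by rw [hz]; norm_num, h2⟩)
  have hspos : 0 < s := by
    rcases hs0.eq_or_lt with h | h
    · rw [← h, hz] at hs; norm_num at hs
    · exact h
  exact ⟨s, ⟨hspos, hs⟩, fun t ht => hmono.injOn ht.1 hspos (ht.2.trans hs.symm)⟩

/-- The space `H(ℂ^ι)` of entire functions with the topology of uniform convergence on compact
sets (the topology induced by the compact-open topology of `C(ι → ℂ, ℂ)`). -/
abbrev EntireFun (ι : Type) [Fintype ι] : Type :=
  {f : C(ι → ℂ, ℂ) // Differentiable ℂ f}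

/-- `T`-predictability of a function `φ` of `(a, x) ∈ ℝ^m × R`. The pair of disjoint sets is
`(Jm, Jp)`, with union `J` and complement `J'`. -/
structure IsPredictable {m : ℕ} {R : Type*} [MetricSpace R] (T : Fin m → ℝ)
    (φ : (Fin m → ℝ) × R → ℂ) : Prop where
  continuous : Continuous φ
  extension : ∀ Jm Jp : Finset (Fin m), Disjoint Jm Jp → (Jm ∪ Jp).Nonempty →
    ∃ F : ({j // j ∉ Jm ∪ Jp} → ℝ) × R → EntireFun {j // j ∈ Jm ∪ Jp},
      Continuous F ∧
      ∀ (a : Fin m → ℝ) (x : R), (∀ j ∈ Jm, a j ≤ -T j) → (∀ j ∈ Jp, T j ≤ a j) →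
        φ (a, x) = (F (fun j => a j, x)).1 (fun j => (a j : ℂ))

/-- The multi-indices `ν ≺ N`, that is `0 ≤ ν_j ≤ N_j` for all `j`. -/
def indices {m : ℕ} (N : Fin m → ℕ+) : Finset (Fin m → ℕ) :=
  Fintype.piFinset fun j => Finset.range (N j + 1)

/-- `binom(N, ν) ((1-a)/2)^ν ((1+a)/2)^(N-ν)` in multi-index notation (used for `ν ≺ N`). -/
noncomputable def weight {m : ℕ} (N : Fin m → ℕ+) (ν : Fin m → ℕ) (a : Fin m → ℝ) : ℝ :=
  ∏ j, ((N j : ℕ).choose (ν j) : ℝ) * ((1 - a j) / 2) ^ ν j *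
    ((1 + a j) / 2) ^ ((N j : ℕ) - ν j)

/-- The node `1 - 2 ν / N ∈ [-1,1]^m`. -/
noncomputable def node {m : ℕ} (N : Fin m → ℕ+) (ν : Fin m → ℕ) : Fin m → ℝ :=
  fun j => 1 - 2 * ((ν j : ℝ) / ((N j : ℕ) : ℝ))

/-- `ρ^n · a = (ρ_1^n a_1, …, ρ_m^n a_m)` for an integer `n`. -/
noncomputable def dilate {m : ℕ} (ρ : Fin m → ℝ) (n : ℤ) (a : Fin m → ℝ) : Fin m → ℝ :=
  fun j => ρ j ^ n * a j

/-- The nested Bernstein sum: the sum over all `ν_0 ≺ N_0, …, ν_k ≺ N_k` of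
`weight N_k ν_k (ρ^(-k)·a) * ∏_{κ<k} weight N_κ ν_κ (ρ·(1-2ν_{κ+1}/N_{κ+1})) * φ (1-2ν_0/N_0, x)`. -/
noncomputable def nestedBernstein {m : ℕ} {R : Type*} (φ : (Fin m → ℝ) × R → ℂ)
    (ρ : Fin m → ℝ) (k : ℕ) (N : Fin (k + 1) → Fin m → ℕ+) (p : (Fin m → ℝ) × R) : ℂ :=
  ∑ ν ∈ Fintype.piFinset fun κ => indices (N κ),
    ((weight (N (Fin.last k)) (ν (Fin.last k)) (dilate ρ (-(k : ℤ)) p.1) *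
      ∏ κ : Fin k, weight (N κ.castSucc) (ν κ.castSucc)
        (dilate ρ 1 (node (N κ.succ) (ν κ.succ))) : ℝ) : ℂ) *
      φ (node (N 0) (ν 0), p.2)

/-- `f_i → g` along `l`, uniformly on every compact subset of `U`. -/
def TendstoOnCompacts {ι X : Type*} [TopologicalSpace X] (f : ι → X → ℂ) (g : X → ℂ)
    (l : Filter ι) (U : Set X) : Prop :=
  ∀ K ⊆ U, IsCompact K → TendstoUniformlyOn f g l K

/-- `g = lim_{N_{n-1}} ( ⋯ ( lim_{N_1} ( lim_{N_0} F(N_0, …, N_{n-1}) ) ) ⋯ )` on `U`, each limit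
being taken along `l`, the one in `N_0` first and the one in `N_{n-1}` last, and each of them (for
all fixed values of the remaining indices) uniformly on every compact subset of `U`. -/
def IsIteratedLimit {ι X : Type*} [TopologicalSpace X] (l : Filter ι) (U : Set X) :
    (n : ℕ) → ((Fin n → ι) → X → ℂ) → (X → ℂ) → Prop
  | 0, F, g => Set.EqOn (F Fin.elim0) g U
  | n + 1, F, g => ∃ G : (Fin n → ι) → X → ℂ,
      (∀ M : Fin n → ι, TendstoOnCompacts (fun N₀ : ι => F (Fin.cons N₀ M)) (G M) l U) ∧
      IsIteratedLimit l U n G g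

/-- The set `(∏_j ]-ρ_j^k r(T_j), ρ_j^k r(T_j)[) × R`. -/
def box {m : ℕ} (R : Type*) (T ρ : Fin m → ℝ) (k : ℕ) : Set ((Fin m → ℝ) × R) :=
  {p | ∀ j, p.1 j ∈ Set.Ioo (-(ρ j ^ k * lemniscateRadius (T j)))
    (ρ j ^ k * lemniscateRadius (T j))}

end Supershift

namespace Supershift

/-! Everything rests on the fact (`tendsto_bernsteinSum`) that the Bernstein polynomials of a
predictable function, although they sample it only in `[-1,1]^m`, converge to it wherever `|a_j| <
r(T_j)`. In one variable there are three mechanisms. For `|a| ≤ 1` the weights are probabilities and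
Bernstein's variance argument applies to every continuous function (`isNodeScheme_interval`). For
arbitrary `a` the moments of the nodes are controlled algebraically, so that entire functions are
approximated through their Taylor series (`isNodeScheme_entire`). For `1 ≤ |a| < r(T)` the nodes not
lying beyond `T` on the side of `a` carry exponentially small absolute mass: the lemniscate
condition is exactly a Chernoff bound (`exists_sum_badWeight_le`). Hence the remaining good nodes
alone already reproduce entire functions (`isNodeScheme_goodWeight`). In several variables, the
polyinterval is cut according to the position of each `a_j` relative to `[-1,1]`, and the Bernstein
sum according to the set `D` of coordinates, among those outside `[-1,1]`, in which the node is bad.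
On the part belonging to `D`, predictability replaces `φ` by a function entire in the good outside
coordinates. Each part is a product of one-variable functionals, whose limits multiply
(`tendsto_nodeSumPi`), and a single bad coordinate makes the limit zero, so only `D = ∅` survives.
Dilation by factors at least `1` preserves predictability. Convergence for `φ ∘ ρ^k` at `ρ^(-k)·a`
is the autosimilarity relation. The iterated limit follows by induction on `k`: the innermost limit
turns `φ` sampled in `[-1,1]^m` into `φ ∘ ρ` sampled there. -/

/-! ### Moments of the Bernstein weights in one variable. -/

/-- The Bernstein weight of degree `N` on `[-1,1]` in one variable. -/
noncomputable def bernsteinWeight (N ν : ℕ) (a : ℝ) : ℝ :=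
  (N.choose ν : ℝ) * ((1 - a) / 2) ^ ν * ((1 + a) / 2) ^ (N - ν)

/-- The Bernstein node `1 - 2ν/N` in one variable. -/
noncomputable def bernsteinNode (N ν : ℕ) : ℝ := 1 - 2 * ((ν : ℝ) / (N : ℝ))

theorem bernsteinWeight_succ_zero (N : ℕ) (a : ℝ) :
    bernsteinWeight (N + 1) 0 a = (1 + a) / 2 * bernsteinWeight N 0 a := by
  simp [bernsteinWeight, pow_succ]; ring

theorem bernsteinWeight_succ_succ {N ν : ℕ} (h : ν ≤ N) (a : ℝ) :
    bernsteinWeight (N + 1) (ν + 1) a =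
      (1 + a) / 2 * bernsteinWeight N (ν + 1) a + (1 - a) / 2 * bernsteinWeight N ν a := by
  rcases h.eq_or_lt with rfl | h
  · simp [bernsteinWeight, pow_succ]; ring
  · obtain ⟨d, rfl⟩ := Nat.exists_eq_add_of_lt h
    have e1 : ν + d + 1 + 1 - (ν + 1) = d + 1 := by omega
    have e2 : ν + d + 1 - (ν + 1) = d := by omega
    have e3 : ν + d + 1 - ν = d + 1 := by omega
    simp only [bernsteinWeight, e1, e2, e3, Nat.choose_succ_succ (ν + d + 1) ν]
    push_cast
    ring

/-- Conditioning on the last of `N + 1` independent signs. This is Pascal's rule, so it holds for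
all real `a`, also where the weights change sign. -/
theorem sum_bernsteinWeight_succ (N : ℕ) (a : ℝ) (g : ℕ → ℝ) :
    ∑ ν ∈ Finset.range (N + 2), bernsteinWeight (N + 1) ν a * g ν =
      ∑ ν ∈ Finset.range (N + 1), bernsteinWeight N ν a *
        ((1 + a) / 2 * g ν + (1 - a) / 2 * g (ν + 1)) := by
  have hz : bernsteinWeight N (N + 1) a = 0 := by simp [bernsteinWeight]
  have h1 : ∑ ν ∈ Finset.range (N + 1), bernsteinWeight N ν a * g ν =
      ∑ ν ∈ Finset.range (N + 1), bernsteinWeight N (ν + 1) a * g (ν + 1) +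
        bernsteinWeight N 0 a * g 0 := by
    rw [← Finset.sum_range_succ' (fun ν => bernsteinWeight N ν a * g ν),
      Finset.sum_range_succ _ (N + 1), hz, zero_mul, add_zero]
  rw [Finset.sum_range_succ', bernsteinWeight_succ_zero,
    Finset.sum_congr rfl fun ν hν => by
      rw [bernsteinWeight_succ_succ (Nat.lt_succ_iff.mp (Finset.mem_range.mp hν))]]
  simp only [mul_add, add_mul, Finset.sum_add_distrib]
  have e1 : ∑ ν ∈ Finset.range (N + 1), bernsteinWeight N ν a * ((1 + a) / 2 * g ν) =
      (1 + a) / 2 * ∑ ν ∈ Finset.range (N + 1), bernsteinWeight N ν a * g ν := by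
    rw [Finset.mul_sum]; exact Finset.sum_congr rfl fun _ _ => by ring
  have e2 : ∑ ν ∈ Finset.range (N + 1), (1 + a) / 2 * bernsteinWeight N (ν + 1) a * g (ν + 1) =
      (1 + a) / 2 * ∑ ν ∈ Finset.range (N + 1), bernsteinWeight N (ν + 1) a * g (ν + 1) := by
    rw [Finset.mul_sum]; exact Finset.sum_congr rfl fun _ _ => by ring
  have e3 : ∑ ν ∈ Finset.range (N + 1), (1 - a) / 2 * bernsteinWeight N ν a * g (ν + 1) =
      ∑ ν ∈ Finset.range (N + 1), bernsteinWeight N ν a * ((1 - a) / 2 * g (ν + 1)) :=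
    Finset.sum_congr rfl fun _ _ => by ring
  rw [e1, e2, e3, h1]
  ring

/-- The `n`-th moment of a sum of `N` independent signs with mean `a`. -/
noncomputable def signMoment (N n : ℕ) (a : ℝ) : ℝ :=
  ∑ ν ∈ Finset.range (N + 1), bernsteinWeight N ν a * ((N : ℝ) - 2 * ν) ^ n

/-- The `k`-th moment of a sign with mean `a`. -/
noncomputable def oneSignMoment (k : ℕ) (a : ℝ) : ℝ := (1 + a) / 2 + (1 - a) / 2 * (-1) ^ k

theorem oneSignMoment_zero (a : ℝ) : oneSignMoment 0 a = 1 := by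
  simp [oneSignMoment]; ring

theorem oneSignMoment_one (a : ℝ) : oneSignMoment 1 a = a := by
  simp [oneSignMoment]; ring

theorem abs_oneSignMoment_le {A a : ℝ} (hA : 1 ≤ A) (ha : |a| ≤ A) (k : ℕ) :
    |oneSignMoment k a| ≤ A ^ k := by
  rcases k with _ | k
  · simp [oneSignMoment_zero]
  · have hk : A ≤ A ^ (k + 1) := le_self_pow₀ hA (by omega)
    rcases neg_one_pow_eq_or ℝ (k + 1) with h | h
    · have : oneSignMoment (k + 1) a = 1 := by rw [oneSignMoment, h]; ring
      rw [this, abs_one]; linarith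
    · have : oneSignMoment (k + 1) a = a := by rw [oneSignMoment, h]; ring
      rw [this]; linarith

theorem signMoment_succ (N n : ℕ) (a : ℝ) :
    signMoment (N + 1) n a = ∑ m ∈ Finset.range (n + 1),
      (n.choose m : ℝ) * (signMoment N m a * oneSignMoment (n - m) a) := by
  rw [signMoment, sum_bernsteinWeight_succ]
  simp only [signMoment, Finset.sum_mul, Finset.mul_sum]
  rw [Finset.sum_comm]
  refine Finset.sum_congr rfl fun ν _ => ?_
  have e1 : ((N + 1 : ℕ) : ℝ) - 2 * ν = ((N : ℝ) - 2 * ν) + 1 := by push_cast; ring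
  have e2 : ((N + 1 : ℕ) : ℝ) - 2 * ((ν + 1 : ℕ) : ℝ) = ((N : ℝ) - 2 * ν) + -1 := by
    push_cast; ring
  rw [e1, e2, add_pow, add_pow, Finset.mul_sum, Finset.mul_sum, ← Finset.sum_add_distrib,
    Finset.mul_sum]
  refine Finset.sum_congr rfl fun m _ => ?_
  rw [oneSignMoment, one_pow]
  ring

theorem signMoment_zero_left (n : ℕ) (a : ℝ) : signMoment 0 n a = 0 ^ n := by
  simp [signMoment, bernsteinWeight]

/-- For `|a| > 1` the weights are not probabilities and the absolute mass may grow exponentially.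
The moments nevertheless stay small: by the recursion in `N` each step costs powers of `A` only, and
the binomial theorem reassembles `(N + 1)^n`. -/
theorem abs_signMoment_le {A a : ℝ} (hA : 1 ≤ A) (ha : |a| ≤ A) (N : ℕ) :
    ∀ n, |signMoment N n a| ≤ A ^ n * (N : ℝ) ^ n := by
  have hA0 : 0 ≤ A := by linarith
  induction N with
  | zero =>
    intro n
    rw [signMoment_zero_left]
    rcases n with _ | n <;> simp
  | succ N ih =>
    intro n
    rw [signMoment_succ]
    refine (Finset.abs_sum_le_sum_abs _ _).trans ?_
    have : ((N + 1 : ℕ) : ℝ) ^ n = ∑ m ∈ Finset.range (n + 1), (N : ℝ) ^ m * n.choose m := by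
      rw [Nat.cast_succ, add_pow]; simp
    rw [this, Finset.mul_sum]
    refine Finset.sum_le_sum fun m hm => ?_
    have hm' : m ≤ n := Nat.lt_succ_iff.mp (Finset.mem_range.mp hm)
    rw [abs_mul, abs_mul, Nat.abs_cast]
    calc (n.choose m : ℝ) * (|signMoment N m a| * |oneSignMoment (n - m) a|)
        ≤ n.choose m * (A ^ m * N ^ m * A ^ (n - m)) := by
          gcongr
          · exact ih m
          · exact abs_oneSignMoment_le hA ha _
      _ = A ^ m * A ^ (n - m) * (N ^ m * n.choose m) := by ring
      _ = _ := by rw [← pow_add, Nat.add_sub_cancel' hm']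

theorem descFactorial_succ_succ' (N n : ℕ) :
    (N + 1).descFactorial (n + 1) = N.descFactorial (n + 1) + (n + 1) * N.descFactorial n := by
  rw [Nat.succ_descFactorial_succ, Nat.descFactorial_succ, ← add_mul]
  rcases le_or_gt n N with h | h
  · congr 1; omega
  · simp [Nat.descFactorial_of_lt h]

/-- Expand the `n`-th power of the sum of `N` signs over `n`-tuples of indices. The `N.descFactorial
n` tuples without repetition contribute exactly `a^n` each; for the others both the moment and `a^n`
are at most `A^n`. The induction on `N` encodes this count. -/
theorem abs_signMoment_sub_le {A a : ℝ} (hA : 1 ≤ A) (ha : |a| ≤ A) (N : ℕ) :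
    ∀ n, |signMoment N n a - (N * a) ^ n| ≤
      2 * A ^ n * ((N : ℝ) ^ n - (N.descFactorial n : ℕ)) := by
  have hA0 : 0 ≤ A := by linarith
  induction N with
  | zero =>
    intro n
    rw [signMoment_zero_left]
    rcases n with _ | n <;> simp
  | succ N ih =>
    intro n
    rw [signMoment_succ]
    have e1 : (((N + 1 : ℕ) : ℝ) * a) ^ n = ∑ m ∈ Finset.range (n + 1),
        (n.choose m : ℝ) * ((N * a) ^ m * a ^ (n - m)) := by
      rw [Nat.cast_succ, add_mul, one_mul, add_pow]
      exact Finset.sum_congr rfl fun _ _ => by ring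
    -- In a tuple without repetition the new index occurs at most once, so only `m = n` and `m = n -
    -- 1` contribute to the falling factorial.
    have e2 : ((N + 1 : ℕ) : ℝ) ^ n - ((N + 1).descFactorial n : ℕ) =
        ∑ m ∈ Finset.range (n + 1), (n.choose m : ℝ) *
          ((N : ℝ) ^ m - if n ≤ m + 1 then (N.descFactorial m : ℝ) else 0) := by
      simp only [mul_sub, Finset.sum_sub_distrib]
      congr 1
      · rw [Nat.cast_succ, add_pow]
        exact Finset.sum_congr rfl fun _ _ => by ring
      · rcases n with _ | n
        · simp
        · rw [Finset.sum_range_succ, Finset.sum_range_succ, Finset.sum_eq_zero]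
          · rw [descFactorial_succ_succ']
            simp
            ring
          · intro m hm
            have : ¬ (n + 1 ≤ m + 1) := by have := Finset.mem_range.mp hm; omega
            rw [if_neg this, mul_zero]
    rw [e1, ← Finset.sum_sub_distrib, e2, Finset.mul_sum]
    refine (Finset.abs_sum_le_sum_abs _ _).trans (Finset.sum_le_sum fun m hm => ?_)
    have hm' : m ≤ n := Nat.lt_succ_iff.mp (Finset.mem_range.mp hm)
    have hAn : A ^ n = A ^ m * A ^ (n - m) := by rw [← pow_add, Nat.add_sub_cancel' hm']
    rw [← mul_sub, abs_mul, Nat.abs_cast]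
    suffices h : |signMoment N m a * oneSignMoment (n - m) a - (N * a) ^ m * a ^ (n - m)| ≤
        2 * A ^ n * ((N : ℝ) ^ m - if n ≤ m + 1 then (N.descFactorial m : ℝ) else 0) by
      calc _ ≤ (n.choose m : ℝ) * _ := mul_le_mul_of_nonneg_left h (Nat.cast_nonneg _)
        _ = _ := by ring
    split_ifs with hc
    · have : oneSignMoment (n - m) a = a ^ (n - m) := by
        have : n - m = 0 ∨ n - m = 1 := by omega
        rcases this with h | h <;> rw [h]
        · rw [oneSignMoment_zero, pow_zero]
        · rw [oneSignMoment_one, pow_one]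
      rw [this, ← sub_mul, abs_mul, abs_pow, hAn]
      calc _ ≤ 2 * A ^ m * ((N : ℝ) ^ m - (N.descFactorial m : ℕ)) * A ^ (n - m) := by
            gcongr
            · exact (abs_nonneg _).trans (ih m)
            · exact ih m
        _ = _ := by ring
    · rw [sub_zero]
      have h1 : |signMoment N m a * oneSignMoment (n - m) a| ≤ A ^ n * N ^ m := by
        rw [abs_mul, hAn]
        calc _ ≤ A ^ m * N ^ m * A ^ (n - m) :=
              mul_le_mul (abs_signMoment_le hA ha N m) (abs_oneSignMoment_le hA ha _)
                (abs_nonneg _) (by positivity)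
          _ = _ := by ring
      have h2 : |((N : ℝ) * a) ^ m * a ^ (n - m)| ≤ A ^ n * N ^ m := by
        rw [abs_mul, abs_pow, abs_pow, abs_mul, mul_pow, Nat.abs_cast, hAn]
        calc _ ≤ (N : ℝ) ^ m * A ^ m * A ^ (n - m) := by gcongr
          _ = _ := by ring
      have h3 := norm_sub_le (signMoment N m a * oneSignMoment (n - m) a)
        (((N : ℝ) * a) ^ m * a ^ (n - m))
      simp only [Real.norm_eq_abs] at h3
      linarith

theorem sum_bernsteinWeight_mul_node_pow {N : ℕ} (hN : N ≠ 0) (n : ℕ) (a : ℝ) :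
    ∑ ν ∈ Finset.range (N + 1), bernsteinWeight N ν a * bernsteinNode N ν ^ n =
      signMoment N n a / (N : ℝ) ^ n := by
  have hN' : (N : ℝ) ≠ 0 := Nat.cast_ne_zero.mpr hN
  rw [signMoment, Finset.sum_div]
  refine Finset.sum_congr rfl fun ν _ => ?_
  have : bernsteinNode N ν = (N - 2 * ν) / N := by
    rw [bernsteinNode]; field_simp
  rw [this, div_pow, mul_div_assoc]

/-- An upper bound, tending to `0`, for the relative error of the Bernstein polynomials of the
`n`-th monomial. -/
noncomputable def momentError (N n : ℕ) : ℝ := 2 * (1 - (N.descFactorial n : ℝ) / (N : ℝ) ^ n)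

theorem momentError_mem {N : ℕ} (hN : N ≠ 0) (n : ℕ) : momentError N n ∈ Set.Icc (0 : ℝ) 2 := by
  have hN' : 0 < (N : ℝ) := Nat.cast_pos.mpr (Nat.pos_of_ne_zero hN)
  have h1 : (N.descFactorial n : ℝ) / (N : ℝ) ^ n ≤ 1 := by
    rw [div_le_one (by positivity)]
    exact_mod_cast Nat.descFactorial_le_pow N n
  have h2 : 0 ≤ (N.descFactorial n : ℝ) / (N : ℝ) ^ n := by positivity
  constructor <;> rw [momentError] <;> linarith

theorem tendsto_momentError (n : ℕ) : Tendsto (fun N => momentError N n) atTop (𝓝 0) := by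
  have h := (Asymptotics.isEquivalent_iff_tendsto_one (l := atTop)
    (v := fun N : ℕ => (N : ℝ) ^ n) (by
      filter_upwards [eventually_ne_atTop 0] with N hN
      exact pow_ne_zero _ (Nat.cast_ne_zero.mpr hN))).mp (isEquivalent_descFactorial n)
  have := (h.const_sub 1).const_mul 2
  simpa [momentError] using! this

theorem abs_sum_bernsteinWeight_mul_node_pow_le {A a : ℝ} (hA : 1 ≤ A) (ha : |a| ≤ A) {N : ℕ}
    (hN : N ≠ 0) (n : ℕ) :
    |∑ ν ∈ Finset.range (N + 1), bernsteinWeight N ν a * bernsteinNode N ν ^ n| ≤ A ^ n := by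
  have hN' : 0 < (N : ℝ) := Nat.cast_pos.mpr (Nat.pos_of_ne_zero hN)
  rw [sum_bernsteinWeight_mul_node_pow hN, abs_div, abs_of_pos (pow_pos hN' n),
    div_le_iff₀ (pow_pos hN' n)]
  exact abs_signMoment_le hA ha N n

theorem abs_sum_bernsteinWeight_mul_node_pow_sub_le {A a : ℝ} (hA : 1 ≤ A) (ha : |a| ≤ A) {N : ℕ}
    (hN : N ≠ 0) (n : ℕ) :
    |∑ ν ∈ Finset.range (N + 1), bernsteinWeight N ν a * bernsteinNode N ν ^ n - a ^ n| ≤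
      A ^ n * momentError N n := by
  have hN' : 0 < (N : ℝ) := Nat.cast_pos.mpr (Nat.pos_of_ne_zero hN)
  have hp := pow_pos hN' n
  rw [sum_bernsteinWeight_mul_node_pow hN]
  have e1 : signMoment N n a / (N : ℝ) ^ n - a ^ n =
      (signMoment N n a - (N * a) ^ n) / (N : ℝ) ^ n := by
    rw [mul_pow]; field_simp
  have e2 : A ^ n * momentError N n =
      2 * A ^ n * ((N : ℝ) ^ n - (N.descFactorial n : ℕ)) / (N : ℝ) ^ n := by
    rw [momentError]; field_simp
  rw [e1, e2, abs_div, abs_of_pos hp]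
  gcongr
  exact abs_signMoment_sub_le hA ha N n

theorem sum_bernsteinWeight {N : ℕ} (a : ℝ) :
    ∑ ν ∈ Finset.range (N + 1), bernsteinWeight N ν a = 1 := by
  have := (add_pow ((1 - a) / 2) ((1 + a) / 2) N).symm
  rw [show (1 - a) / 2 + (1 + a) / 2 = 1 by ring, one_pow] at this
  rw [← this]
  exact Finset.sum_congr rfl fun _ _ => by rw [bernsteinWeight]; ring

theorem bernsteinWeight_nonneg {a : ℝ} (ha : a ∈ Set.Icc (-1 : ℝ) 1) (N ν : ℕ) :
    0 ≤ bernsteinWeight N ν a := by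
  have h1 : 0 ≤ (1 - a) / 2 := by linarith [ha.2]
  have h2 : 0 ≤ (1 + a) / 2 := by linarith [ha.1]
  rw [bernsteinWeight]; positivity

theorem bernsteinNode_mem {N ν : ℕ} (h : ν ∈ Finset.range (N + 1)) :
    bernsteinNode N ν ∈ Set.Icc (-1 : ℝ) 1 := by
  have hν : (ν : ℝ) ≤ N := by exact_mod_cast Nat.lt_succ_iff.mp (Finset.mem_range.mp h)
  have h1 : (ν : ℝ) / N ≤ 1 := div_le_one_of_le₀ hν (Nat.cast_nonneg _)
  have h2 : 0 ≤ (ν : ℝ) / N := by positivity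
  constructor <;> rw [bernsteinNode] <;> linarith

/-- The first moment is exact because `N.descFactorial 1 = N`; the variance is therefore the error
of the second moment. -/
theorem sum_bernsteinWeight_mul_sq_le {a : ℝ} (ha : a ∈ Set.Icc (-1 : ℝ) 1) {N : ℕ} (hN : N ≠ 0) :
    ∑ ν ∈ Finset.range (N + 1), bernsteinWeight N ν a * (bernsteinNode N ν - a) ^ 2 ≤
      momentError N 2 := by
  have h0 := sum_bernsteinWeight (N := N) a
  have hab : |a| ≤ 1 := abs_le.mpr ha
  have h1 := abs_sum_bernsteinWeight_mul_node_pow_sub_le le_rfl hab hN 1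
  have h2 := (abs_le.mp (abs_sum_bernsteinWeight_mul_node_pow_sub_le le_rfl hab hN 2)).2
  have hN' : (N : ℝ) ≠ 0 := Nat.cast_ne_zero.mpr hN
  have hz : momentError N 1 = 0 := by simp [momentError, hN']
  rw [hz, mul_zero, abs_nonpos_iff, sub_eq_zero] at h1
  simp only [one_pow, pow_one, one_mul] at h1 h2
  have e : ∑ ν ∈ Finset.range (N + 1), bernsteinWeight N ν a * (bernsteinNode N ν - a) ^ 2 =
      ∑ ν ∈ Finset.range (N + 1), bernsteinWeight N ν a * bernsteinNode N ν ^ 2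
        - 2 * a * ∑ ν ∈ Finset.range (N + 1), bernsteinWeight N ν a * bernsteinNode N ν
        + a ^ 2 * ∑ ν ∈ Finset.range (N + 1), bernsteinWeight N ν a := by
    rw [Finset.mul_sum, Finset.mul_sum, ← Finset.sum_sub_distrib, ← Finset.sum_add_distrib]
    exact Finset.sum_congr rfl fun _ _ => by ring
  rw [e, h0, h1]
  linarith

/-! ### Bernstein functionals on entire functions. -/

theorem tendstoUniformlyOn_of_norm_sub_le {ι X : Type*} {l : Filter ι} {F : ι → X → ℂ} {g : X → ℂ}
    {s : Set X} {b : ι → ℝ} (hb : Tendsto b l (𝓝 0))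
    (h : ∀ᶠ i in l, ∀ x ∈ s, ‖F i x - g x‖ ≤ b i) : TendstoUniformlyOn F g l s := by
  rw [Metric.tendstoUniformlyOn_iff]
  intro ε hε
  filter_upwards [h, hb.eventually_lt_const hε] with i hi hbi x hx
  rw [dist_comm, dist_eq_norm]
  exact (hi x hx).trans_lt hbi

/-- The functional `f ↦ ∑_ν c N ν a f(1 - 2ν/N)` on functions of one complex variable. -/
noncomputable def nodeSum (c : ℕ → ℕ → ℝ → ℝ) (N : ℕ) (a : ℝ) (f : ℂ → ℂ) : ℂ :=
  ∑ ν ∈ Finset.range (N + 1), (c N ν a : ℂ) * f (bernsteinNode N ν : ℂ)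

theorem hasSum_nodeSum (c : ℕ → ℕ → ℝ → ℝ) (N : ℕ) (a : ℝ) {f : ℂ → ℂ} {u : ℕ → ℂ}
    (hf : ∀ z, HasSum (fun n => u n * z ^ n) (f z)) :
    HasSum (fun n => u n *
      ((∑ ν ∈ Finset.range (N + 1), c N ν a * bernsteinNode N ν ^ n : ℝ) : ℂ))
      (nodeSum c N a f) := by
  have := hasSum_sum (s := Finset.range (N + 1)) fun ν _ =>
    (hf (bernsteinNode N ν : ℂ)).mul_left (c N ν a : ℂ)
  refine this.congr_fun ?_
  intro n
  push_cast
  rw [Finset.mul_sum]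
  exact Finset.sum_congr rfl fun _ _ => by ring

/-- The Taylor coefficients at `0`. -/
noncomputable def taylorCoeff (f : ℂ → ℂ) (n : ℕ) : ℂ := (n.factorial : ℂ)⁻¹ * iteratedDeriv n f 0

theorem hasSum_taylorCoeff {f : ℂ → ℂ} (hf : Differentiable ℂ f) (z : ℂ) :
    HasSum (fun n => taylorCoeff f n * z ^ n) (f z) := by
  have := Complex.hasSum_taylorSeries_of_entire hf 0 z
  refine this.congr_fun fun n => ?_
  simp only [taylorCoeff, sub_zero, smul_eq_mul]
  ring

theorem norm_taylorCoeff_le {f : ℂ → ℂ} (hf : Differentiable ℂ f) {r M : ℝ} (hr : 0 < r)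
    (hM : ∀ z ∈ Metric.closedBall (0 : ℂ) r, ‖f z‖ ≤ M) (n : ℕ) : ‖taylorCoeff f n‖ ≤ M / r ^ n := by
  have h := Complex.norm_iteratedDeriv_le_of_forall_mem_sphere_norm_le n hr hf.diffContOnCl
    fun z hz => hM z (Metric.sphere_subset_closedBall hz)
  have hn : (0 : ℝ) < n.factorial := by positivity
  rw [taylorCoeff, norm_mul, norm_inv, Complex.norm_natCast, inv_mul_le_iff₀ hn]
  rwa [← mul_div_assoc]

/-- On radius `2 * A` Cauchy's estimates give Taylor coefficients at most `M / (2A)^n`, against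
moments at most `A^n`: a geometric series of ratio `1/2`. -/
theorem norm_nodeSum_bernsteinWeight_le {A a : ℝ} (hA : 1 ≤ A) (ha : |a| ≤ A) {N : ℕ}
    (hN : N ≠ 0) {f : ℂ → ℂ} (hf : Differentiable ℂ f) {M : ℝ}
    (hM : ∀ z ∈ Metric.closedBall (0 : ℂ) (2 * A), ‖f z‖ ≤ M) :
    ‖nodeSum bernsteinWeight N a f‖ ≤ 2 * M := by
  have hA0 : 0 < A := by linarith
  have hs := hasSum_nodeSum bernsteinWeight N a (hasSum_taylorCoeff hf)
  have hg := hasSum_geometric_two.mul_right M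
  refine hs.norm_le_of_bounded hg fun n => ?_
  rw [norm_mul, Complex.norm_real, Real.norm_eq_abs]
  calc _ ≤ M / (2 * A) ^ n * A ^ n :=
        mul_le_mul (norm_taylorCoeff_le hf (by positivity) hM n)
          (abs_sum_bernsteinWeight_mul_node_pow_le hA ha hN n) (abs_nonneg _)
          ((norm_nonneg _).trans (norm_taylorCoeff_le hf (by positivity) hM n))
    _ = _ := by rw [mul_pow, div_pow, one_pow]; field_simp

/-- An upper bound, tending to `0`, for the error of Bernstein approximation of an entire function
whose absolute value is at most `1` on a large disc. -/
noncomputable def entireError (N : ℕ) : ℝ := ∑' n, (1 / 2 : ℝ) ^ n * momentError N n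

theorem norm_momentError_mul_le {N : ℕ} (hN : N ≠ 0) (n : ℕ) :
    ‖(1 / 2 : ℝ) ^ n * momentError N n‖ ≤ (1 / 2 : ℝ) ^ n * 2 := by
  obtain ⟨h0, h2⟩ := momentError_mem hN n
  rw [norm_mul, Real.norm_of_nonneg h0, Real.norm_of_nonneg (by positivity)]
  gcongr

theorem tendsto_entireError : Tendsto entireError atTop (𝓝 0) := by
  have := tendsto_tsum_of_dominated_convergence (𝓕 := atTop)
    (f := fun (N n : ℕ) => (1 / 2 : ℝ) ^ n * momentError N n) (g := fun _ => 0)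
    (bound := fun n => (1 / 2 : ℝ) ^ n * 2) (summable_geometric_two.mul_right 2)
    (fun n => by simpa using (tendsto_momentError n).const_mul ((1 / 2 : ℝ) ^ n))
    (by filter_upwards [eventually_ne_atTop 0] with N hN n using norm_momentError_mul_le hN n)
  rwa [tsum_zero] at this

theorem norm_nodeSum_bernsteinWeight_sub_le {A a : ℝ} (hA : 1 ≤ A) (ha : |a| ≤ A) {N : ℕ}
    (hN : N ≠ 0) {f : ℂ → ℂ} (hf : Differentiable ℂ f) {M : ℝ}
    (hM : ∀ z ∈ Metric.closedBall (0 : ℂ) (2 * A), ‖f z‖ ≤ M) :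
    ‖nodeSum bernsteinWeight N a f - f a‖ ≤ entireError N * M := by
  have hA0 : 0 < A := by linarith
  have hs := (hasSum_nodeSum bernsteinWeight N a (hasSum_taylorCoeff hf)).sub
    (hasSum_taylorCoeff hf a)
  have hg := (Summable.of_norm_bounded (summable_geometric_two.mul_right 2)
    (norm_momentError_mul_le hN)).hasSum.mul_right M
  refine hs.norm_le_of_bounded hg fun n => ?_
  rw [← mul_sub, norm_mul, ← Complex.ofReal_pow, ← Complex.ofReal_sub, Complex.norm_real,
    Real.norm_eq_abs]
  calc _ ≤ M / (2 * A) ^ n * (A ^ n * momentError N n) :=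
        mul_le_mul (norm_taylorCoeff_le hf (by positivity) hM n)
          (abs_sum_bernsteinWeight_mul_node_pow_sub_le hA ha hN n) (abs_nonneg _)
          ((norm_nonneg _).trans (norm_taylorCoeff_le hf (by positivity) hM n))
    _ = _ := by rw [mul_pow, div_pow, one_pow]; field_simp

theorem norm_nodeSum_le {c : ℕ → ℕ → ℝ → ℝ} {N : ℕ} {a S M : ℝ}
    (hS : ∑ ν ∈ Finset.range (N + 1), |c N ν a| ≤ S) {f : ℂ → ℂ} (hM0 : 0 ≤ M)
    (hM : ∀ ν ∈ Finset.range (N + 1), ‖f (bernsteinNode N ν)‖ ≤ M) :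
    ‖nodeSum c N a f‖ ≤ S * M := by
  refine (norm_sum_le _ _).trans ?_
  calc _ ≤ ∑ ν ∈ Finset.range (N + 1), |c N ν a| * M := by
        refine Finset.sum_le_sum fun ν hν => ?_
        rw [norm_mul, Complex.norm_real, Real.norm_eq_abs]
        exact mul_le_mul_of_nonneg_left (hM ν hν) (abs_nonneg _)
    _ ≤ _ := by
        rw [← Finset.sum_mul]
        exact mul_le_mul_of_nonneg_right hS hM0

theorem bernsteinNode_mem_closedBall {N ν : ℕ} (h : ν ∈ Finset.range (N + 1)) {r : ℝ}
    (hr : 1 ≤ r) : (bernsteinNode N ν : ℂ) ∈ Metric.closedBall (0 : ℂ) r := by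
  rw [mem_closedBall_zero_iff, Complex.norm_real, Real.norm_eq_abs]
  exact (abs_le.mpr (bernsteinNode_mem h)).trans hr

theorem exists_norm_le_of_continuous {X : Type*} [TopologicalSpace X] {G : ℂ × X → ℂ}
    (hG : Continuous G) (r : ℝ) {K : Set X} (hK : IsCompact K) :
    ∃ M, 0 ≤ M ∧ ∀ z ∈ Metric.closedBall (0 : ℂ) r, ∀ x ∈ K, ‖G (z, x)‖ ≤ M := by
  obtain ⟨M, hM⟩ := ((isCompact_closedBall (0 : ℂ) r).prod hK).exists_bound_of_continuousOn
    hG.continuousOn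
  exact ⟨max M 0, le_max_right _ _, fun z hz x hx => (hM (z, x) ⟨hz, hx⟩).trans (le_max_left _ _)⟩

/-! ### Node schemes: uniformly bounded, convergent families of functionals. -/

/-- The functionals `nodeSum c N a`, `a ∈ A`, are bounded, uniformly in `N`, and converge for
`N → ∞` to `l` times the evaluation at `a`, on continuous functions (of one complex variable and of
parameters) which moreover are supposed to be entire if `e` holds. -/
structure IsNodeScheme.{u} (c : ℕ → ℕ → ℝ → ℝ) (A : Set ℝ) (e : Prop) (l : ℂ) : Prop where
  isCompact : IsCompact A
  bounded : ∃ C r : ℝ, 0 ≤ C ∧ ∀ N ≠ 0, ∀ a ∈ A, ∀ f : ℂ → ℂ, (e → Differentiable ℂ f) →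
    ∀ M, 0 ≤ M → (∀ z ∈ Metric.closedBall (0 : ℂ) r, ‖f z‖ ≤ M) → ‖nodeSum c N a f‖ ≤ C * M
  tendsto : ∀ {X : Type u} [PseudoMetricSpace X] (G : ℂ × X → ℂ), Continuous G →
    (e → ∀ x, Differentiable ℂ fun z => G (z, x)) → ∀ K : Set X, IsCompact K →
      TendstoUniformlyOn (fun N (p : ℝ × X) => nodeSum c N p.1 fun z => G (z, p.2))
        (fun p => l * G (p.1, p.2)) atTop (A ×ˢ K)

theorem isNodeScheme_entire {A : ℝ} (hA : 1 ≤ A) {S : Set ℝ} (hS : IsCompact S)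
    (hSA : ∀ a ∈ S, |a| ≤ A) : IsNodeScheme bernsteinWeight S True 1 where
  isCompact := hS
  bounded := ⟨2, 2 * A, by norm_num, fun N hN a ha f hf M _ hM =>
    norm_nodeSum_bernsteinWeight_le hA (hSA a ha) hN (hf trivial) hM⟩
  tendsto := by
    intro X _ G hG hd K hK
    obtain ⟨M, _, hM⟩ := exists_norm_le_of_continuous hG (2 * A) hK
    refine tendstoUniformlyOn_of_norm_sub_le
      (by simpa using! tendsto_entireError.mul_const M) ?_
    filter_upwards [eventually_ne_atTop 0] with N hN p hp
    rw [one_mul]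
    exact norm_nodeSum_bernsteinWeight_sub_le hA (hSA p.1 hp.1) hN (hd trivial p.2)
      fun z hz => hM z hz p.2 hp.2

theorem isNodeScheme_of_mass {c : ℕ → ℕ → ℝ → ℝ} {S : Set ℝ} (hS : IsCompact S) {b : ℕ → ℝ}
    (hb : Tendsto b atTop (𝓝 0)) (hb1 : ∀ N, b N ≤ 1)
    (h : ∀ N ≠ 0, ∀ a ∈ S, ∑ ν ∈ Finset.range (N + 1), |c N ν a| ≤ b N) : IsNodeScheme c S False 0 where
  isCompact := hS
  bounded := ⟨1, 1, zero_le_one, fun N hN a ha f _ M hM0 hM =>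
    norm_nodeSum_le ((h N hN a ha).trans (hb1 N)) hM0
      fun ν hν => hM _ (bernsteinNode_mem_closedBall hν le_rfl)⟩
  tendsto := by
    intro X _ G hG _ K hK
    obtain ⟨M, hM0, hM⟩ := exists_norm_le_of_continuous hG 1 hK
    refine tendstoUniformlyOn_of_norm_sub_le (by simpa using! hb.mul_const M) ?_
    filter_upwards [eventually_ne_atTop 0] with N hN p hp
    rw [zero_mul, sub_zero]
    exact norm_nodeSum_le (h N hN p.1 hp.1) hM0
      fun ν hν => hM _ (bernsteinNode_mem_closedBall hν le_rfl) p.2 hp.2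

theorem nodeSum_sub_left (c d : ℕ → ℕ → ℝ → ℝ) (N : ℕ) (a : ℝ) (f : ℂ → ℂ) :
    nodeSum (fun N ν a => c N ν a - d N ν a) N a f = nodeSum c N a f - nodeSum d N a f := by
  simp only [nodeSum, Complex.ofReal_sub, sub_mul, Finset.sum_sub_distrib]

theorem nodeSum_sub_right (c : ℕ → ℕ → ℝ → ℝ) (N : ℕ) (a : ℝ) (f g : ℂ → ℂ) :
    nodeSum c N a (fun z => f z - g z) = nodeSum c N a f - nodeSum c N a g := by
  simp only [nodeSum, mul_sub, Finset.sum_sub_distrib]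

theorem IsNodeScheme.sub.{u} {c d : ℕ → ℕ → ℝ → ℝ} {S : Set ℝ} {e : Prop} {l k : ℂ}
    (hc : IsNodeScheme.{u} c S e l) (hd : IsNodeScheme.{u} d S False k) :
    IsNodeScheme.{u} (fun N ν a => c N ν a - d N ν a) S e (l - k) where
  isCompact := hc.isCompact
  bounded := by
    obtain ⟨C, r, hC, h⟩ := hc.bounded
    obtain ⟨C', r', hC', h'⟩ := hd.bounded
    refine ⟨C + C', max r r', by positivity, fun N hN a ha f hf M hM0 hM => ?_⟩
    rw [nodeSum_sub_left, add_mul]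
    refine (norm_sub_le _ _).trans (add_le_add (h N hN a ha f hf M hM0 fun z hz => hM z ?_)
      (h' N hN a ha f False.elim M hM0 fun z hz => hM z ?_))
    · exact Metric.closedBall_subset_closedBall (le_max_left _ _) hz
    · exact Metric.closedBall_subset_closedBall (le_max_right _ _) hz
  tendsto := by
    intro X _ G hG he K hK
    have := (hc.tendsto G hG he K hK).sub (hd.tendsto G hG False.elim K hK)
    refine (this.congr (.of_forall fun N p _ => ?_)).congr_right fun p _ => ?_
    · exact (nodeSum_sub_left c d N p.1 _).symm
    · simp [sub_mul]

/-- Bernstein's proof of Weierstrass' theorem: uniform continuity handles the nodes within `δ` of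
`a`, Chebyshev's inequality the others. Compactness of `K` makes it uniform in the parameter. -/
theorem isNodeScheme_interval : IsNodeScheme bernsteinWeight (Set.Icc (-1) 1) False 1 where
  isCompact := isCompact_Icc
  bounded := ⟨1, 1, zero_le_one, fun N _ a ha f _ M hM0 hM =>
    norm_nodeSum_le (by
      rw [Finset.sum_congr rfl fun ν _ => abs_of_nonneg (bernsteinWeight_nonneg ha N ν),
        sum_bernsteinWeight]) hM0
      fun ν hν => hM _ (bernsteinNode_mem_closedBall hν le_rfl)⟩
  tendsto := by
    intro X _ G hG _ K hK
    obtain ⟨M, hM0, hM⟩ := exists_norm_le_of_continuous hG 1 hK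
    have hu := ((isCompact_closedBall (0 : ℂ) 1).prod hK).uniformContinuousOn_of_continuous
      hG.continuousOn
    rw [Metric.uniformContinuousOn_iff] at hu
    rw [Metric.tendstoUniformlyOn_iff]
    intro ε hε
    obtain ⟨δ, hδ, hu⟩ := hu (ε / 2) (by positivity)
    have hlim : Tendsto (fun N => 2 * M / δ ^ 2 * momentError N 2) atTop (𝓝 0) := by
      simpa using! (tendsto_momentError 2).const_mul (2 * M / δ ^ 2)
    filter_upwards [eventually_ne_atTop 0, hlim.eventually_lt_const (show 0 < ε / 2 by positivity)]
      with N hN hNε p hp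
    obtain ⟨a, x⟩ := p
    obtain ⟨ha, hx⟩ := hp
    have haB : (a : ℂ) ∈ Metric.closedBall (0 : ℂ) 1 := by
      rw [mem_closedBall_zero_iff, Complex.norm_real, Real.norm_eq_abs]
      exact abs_le.mpr ha
    have hsum : (∑ ν ∈ Finset.range (N + 1), (bernsteinWeight N ν a : ℂ)) = 1 := by
      exact_mod_cast sum_bernsteinWeight a
    rw [dist_comm, dist_eq_norm, one_mul]
    have e1 : nodeSum bernsteinWeight N a (fun z => G (z, x)) - G (a, x) =
        ∑ ν ∈ Finset.range (N + 1), (bernsteinWeight N ν a : ℂ) *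
          (G (bernsteinNode N ν, x) - G (a, x)) := by
      simp only [mul_sub, Finset.sum_sub_distrib, ← Finset.sum_mul, hsum, one_mul, nodeSum]
    have e2 : ∀ ν ∈ Finset.range (N + 1), ‖G (bernsteinNode N ν, x) - G (a, x)‖ ≤
        ε / 2 + 2 * M / δ ^ 2 * (bernsteinNode N ν - a) ^ 2 := by
      intro ν hν
      have hyB := bernsteinNode_mem_closedBall hν (r := 1) le_rfl
      by_cases hd : |bernsteinNode N ν - a| < δ
      · have : dist ((bernsteinNode N ν : ℂ), x) ((a : ℂ), x) < δ := by
          rw [Prod.dist_eq, dist_self, dist_eq_norm, ← Complex.ofReal_sub, Complex.norm_real,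
            Real.norm_eq_abs]
          exact max_lt hd hδ
        have := (hu _ ⟨hyB, hx⟩ _ ⟨haB, hx⟩ this).le
        rw [dist_eq_norm] at this
        have h0 : 0 ≤ 2 * M / δ ^ 2 * (bernsteinNode N ν - a) ^ 2 := by positivity
        linarith
      · have h1 : δ ^ 2 ≤ (bernsteinNode N ν - a) ^ 2 := by
          rw [← sq_abs (bernsteinNode N ν - a)]
          exact pow_le_pow_left₀ hδ.le (not_lt.mp hd) 2
        have h2 : 2 * M ≤ 2 * M / δ ^ 2 * (bernsteinNode N ν - a) ^ 2 := by
          rw [div_mul_eq_mul_div, le_div_iff₀ (by positivity)]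
          exact mul_le_mul_of_nonneg_left h1 (by positivity)
        have h3 := norm_sub_le (G (bernsteinNode N ν, x)) (G (a, x))
        have h4 := hM _ hyB x hx
        have h5 := hM _ haB x hx
        linarith
    calc ‖nodeSum bernsteinWeight N a (fun z => G (z, x)) - G (a, x)‖
        ≤ ∑ ν ∈ Finset.range (N + 1), bernsteinWeight N ν a *
            (ε / 2 + 2 * M / δ ^ 2 * (bernsteinNode N ν - a) ^ 2) := by
          rw [e1]
          refine (norm_sum_le _ _).trans (Finset.sum_le_sum fun ν hν => ?_)
          have hw := bernsteinWeight_nonneg ha N ν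
          rw [norm_mul, Complex.norm_real, Real.norm_of_nonneg hw]
          exact mul_le_mul_of_nonneg_left (e2 ν hν) hw
      _ = ε / 2 + 2 * M / δ ^ 2 * ∑ ν ∈ Finset.range (N + 1),
            bernsteinWeight N ν a * (bernsteinNode N ν - a) ^ 2 := by
          simp only [mul_add, Finset.sum_add_distrib, ← Finset.sum_mul, sum_bernsteinWeight]
          rw [one_mul, Finset.mul_sum]
          congr 1
          exact Finset.sum_congr rfl fun _ _ => by ring
      _ ≤ ε / 2 + 2 * M / δ ^ 2 * momentError N 2 := by
          gcongr
          exact sum_bernsteinWeight_mul_sq_le ha hN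
      _ < ε := by linarith

/-- Convergence of a node scheme applied to a converging family of functions. -/
theorem IsNodeScheme.tendsto_family.{u, v} {c : ℕ → ℕ → ℝ → ℝ} {S : Set ℝ} {e : Prop} {l : ℂ}
    (hc : IsNodeScheme.{u} c S e l) {X : Type u} [PseudoMetricSpace X] {ι : Type v} {L : Filter ι}
    {n : ι → ℕ} (hn : Tendsto n L atTop) {H : ι → ℂ × X → ℂ} {G : ℂ × X → ℂ} (hG : Continuous G)
    (hGe : e → ∀ x, Differentiable ℂ fun z => G (z, x))
    (hHe : e → ∀ i x, Differentiable ℂ fun z => H i (z, x)) {K : Set X} (hK : IsCompact K)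
    (hH : ∀ r : ℝ, TendstoUniformlyOn H G L (Metric.closedBall (0 : ℂ) r ×ˢ K)) :
    TendstoUniformlyOn (fun i (p : ℝ × X) => nodeSum c (n i) p.1 fun z => H i (z, p.2))
      (fun p => l * G (p.1, p.2)) L (S ×ˢ K) := by
  obtain ⟨C, r, hC, hb⟩ := hc.bounded
  have h1 := hc.tendsto G hG hGe K hK
  have h2 := hH r
  rw [Metric.tendstoUniformlyOn_iff] at h1 h2 ⊢
  intro ε hε
  -- The `+ 1` allows `C = 0`.
  have hε' : 0 < ε / (2 * (C + 1)) := by positivity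
  filter_upwards [hn.eventually (h1 (ε / 2) (by positivity)), h2 _ hε',
    hn.eventually (eventually_ne_atTop 0)] with i hi1 hi2 hi0 p hp
  have h3 := hi1 p hp
  have h4 := hb (n i) hi0 p.1 hp.1 (fun z => H i (z, p.2) - G (z, p.2))
    (fun he => (hHe he i p.2).sub (hGe he p.2)) _ hε'.le fun z hz => by
      have := hi2 (z, p.2) ⟨hz, hp.2⟩
      rw [dist_comm, dist_eq_norm] at this
      exact this.le
  rw [nodeSum_sub_right] at h4
  have h5 : C * (ε / (2 * (C + 1))) ≤ ε / 2 := by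
    rw [← mul_div_assoc, div_le_div_iff₀ (by positivity) (by norm_num)]
    nlinarith
  calc _ ≤ _ := dist_triangle _ (nodeSum c (n i) p.1 fun z => G (z, p.2)) _
    _ < ε := by
      rw [dist_comm _ (nodeSum c (n i) p.1 fun z => H i (z, p.2)),
        dist_eq_norm (nodeSum c (n i) p.1 fun z => H i (z, p.2))]
      linarith

/-! ### The lemniscate radius and the Chernoff bound for bad nodes. -/

theorem exists_lemniscateRadius_eq {T : ℝ} (hT : T ∈ Set.Ico (0 : ℝ) 1) :
    ∃ s, 0 < s ∧ lemniscateFun T s = 1 ∧ lemniscateRadius T = 1 + s := by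
  obtain ⟨s₀, ⟨h0, h1⟩, hu⟩ := existsUnique_root hT
  have hset : {s : ℝ | 0 < s ∧ lemniscateFun T s = 1} = {s₀} := by
    ext t
    exact ⟨fun ht => hu t ht, fun ht => by rw [Set.mem_singleton_iff.mp ht]; exact ⟨h0, h1⟩⟩
  exact ⟨s₀, h0, h1, by rw [lemniscateRadius, hset, csInf_singleton]⟩

theorem lemniscateFun_lt_one {T s : ℝ} (hT : T ∈ Set.Ico (0 : ℝ) 1) (hs : 0 < s)
    (hs' : 1 + s < lemniscateRadius T) : lemniscateFun T s < 1 := by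
  obtain ⟨s₀, h0, h1, hr⟩ := exists_lemniscateRadius_eq hT
  rw [hr] at hs'
  have hm : 0 < 1 - T := by linarith [hT.2]
  have hp : 0 < 1 + T := by linarith [hT.1]
  have hlt : s < s₀ := by linarith
  rw [← h1]
  unfold lemniscateFun
  have a1 : (s / (1 - T)) ^ (1 - T) < (s₀ / (1 - T)) ^ (1 - T) :=
    Real.rpow_lt_rpow (by positivity) (by gcongr) hm
  have a2 : ((s + 2) / (1 + T)) ^ (1 + T) < ((s₀ + 2) / (1 + T)) ^ (1 + T) :=
    Real.rpow_lt_rpow (by positivity) (by gcongr) hp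
  exact mul_lt_mul'' a1 a2 (by positivity) (by positivity)

theorem one_lt_lemniscateRadius {T : ℝ} (hT : T ∈ Set.Ico (0 : ℝ) 1) : 1 < lemniscateRadius T := by
  obtain ⟨s₀, h0, h1, hr⟩ := exists_lemniscateRadius_eq hT
  rw [hr]
  linarith

/-- The Bernstein weights of the nodes where `σ y < T`. -/
noncomputable def badWeight (σ T : ℝ) (N ν : ℕ) (a : ℝ) : ℝ :=
  if T ≤ σ * bernsteinNode N ν then 0 else bernsteinWeight N ν a

/-- The Bernstein weights of the nodes where `σ y ≥ T`. -/
noncomputable def goodWeight (σ T : ℝ) (N ν : ℕ) (a : ℝ) : ℝ :=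
  if T ≤ σ * bernsteinNode N ν then bernsteinWeight N ν a else 0

/-- The witness `z` minimises `(z t + 1 + t) / z^q`, and the minimum is the left side of `h`; `B` is
`z^(-q)`. The condition forces `t < q`, whence `1 ≤ z`. -/
theorem exists_chernoff {t q : ℝ} (ht : 0 < t) (hq : 0 < q) (hq1 : q < 1)
    (h : (t / q) ^ q * ((1 + t) / (1 - q)) ^ (1 - q) < 1) :
    ∃ z B : ℝ, 1 ≤ z ∧ 0 < B ∧ 1 ≤ z ^ q * B ∧ (z * t + (1 + t)) * B < 1 := by
  have hq' : 0 < 1 - q := by linarith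
  have htq : t < q := by
    by_contra hc
    have h1 : 1 ≤ (t / q) ^ q := Real.one_le_rpow ((one_le_div hq).mpr (not_lt.mp hc)) hq.le
    have h2 : 1 ≤ ((1 + t) / (1 - q)) ^ (1 - q) :=
      Real.one_le_rpow ((one_le_div hq').mpr (by linarith)) hq'.le
    exact absurd (one_le_mul_of_one_le_of_one_le h1 h2) (not_le.mpr h)
  have hzpos : 0 < q * (1 + t) / (t * (1 - q)) := by positivity
  refine ⟨q * (1 + t) / (t * (1 - q)), ((q * (1 + t) / (t * (1 - q))) ^ q)⁻¹, ?_, by positivity,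
    ?_, ?_⟩
  · rw [one_le_div (by positivity)]
    nlinarith
  · rw [mul_inv_cancel₀ (by positivity)]
  · have e1 : q * (1 + t) / (t * (1 - q)) * t + (1 + t) = (1 + t) / (1 - q) := by
      field_simp; ring
    have e2 : q * (1 + t) / (t * (1 - q)) = ((1 + t) / (1 - q)) / (t / q) := by
      field_simp
    rw [e1, e2, Real.div_rpow (by positivity) (by positivity), inv_div]
    rw [Real.rpow_sub (by positivity), Real.rpow_one] at h
    calc _ = _ := by ring
      _ < 1 := h

theorem abs_bernsteinWeight_le {a b : ℝ} (ha : 1 ≤ a) (hab : a ≤ b) (N ν : ℕ) :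
    |bernsteinWeight N ν a| ≤
      (N.choose ν : ℝ) * ((b - 1) / 2) ^ ν * (1 + (b - 1) / 2) ^ (N - ν) := by
  have h1 : |(1 - a) / 2| ≤ (b - 1) / 2 := by rw [abs_le]; constructor <;> linarith
  have h2 : |(1 + a) / 2| ≤ 1 + (b - 1) / 2 := by rw [abs_le]; constructor <;> linarith
  have h3 : 0 ≤ (b - 1) / 2 := by linarith
  rw [bernsteinWeight, abs_mul, abs_mul, abs_pow, abs_pow, Nat.abs_cast]
  gcongr

/-- A node is bad exactly if `ν > q N`. Then the factor `z^ν B^N` is at least `1`; inserting it and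
summing over all `ν` gives `((z t + 1 + t) B)^N` by the binomial theorem. -/
theorem exists_sum_badWeight_le {T b : ℝ} (hT : T ∈ Set.Ico (0 : ℝ) 1) (hb : 1 < b)
    (hb' : b < lemniscateRadius T) : ∃ r : ℝ, 0 ≤ r ∧ r < 1 ∧ ∀ N ≠ 0, ∀ a ∈ Set.Icc 1 b,
      ∑ ν ∈ Finset.range (N + 1), |badWeight 1 T N ν a| ≤ r ^ N := by
  obtain ⟨hT0, hT1⟩ := hT
  have hlem := lemniscateFun_lt_one ⟨hT0, hT1⟩ (s := b - 1) (by linarith) (by linarith)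
  set t := (b - 1) / 2 with ht_def
  set q := (1 - T) / 2 with hq_def
  have ht : 0 < t := by rw [ht_def]; linarith
  have hq : 0 < q := by rw [hq_def]; linarith
  have hq1 : q < 1 := by rw [hq_def]; linarith
  have hq' : 0 < 1 - q := by linarith
  have hlt : (t / q) ^ q * ((1 + t) / (1 - q)) ^ (1 - q) < 1 := by
    -- With `t = (b-1)/2` and `q = (1-T)/2` the lemniscate function is the square of the Chernoff
    -- quantity.
    have e : lemniscateFun T (b - 1) = ((t / q) ^ q * ((1 + t) / (1 - q)) ^ (1 - q)) ^ 2 := by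
      have e1 : (b - 1) / (1 - T) = t / q := by
        rw [ht_def, hq_def, div_div_div_cancel_right₀ two_ne_zero]
      have e2 : (b - 1 + 2) / (1 + T) = (1 + t) / (1 - q) := by
        have : (0 : ℝ) < 1 + T := by linarith
        rw [div_eq_div_iff this.ne' hq'.ne']
        rw [ht_def, hq_def]; ring
      have e3 : 1 - T = q * (2 : ℕ) := by rw [hq_def]; push_cast; ring
      have e4 : 1 + T = (1 - q) * (2 : ℕ) := by rw [hq_def]; push_cast; ring
      rw [lemniscateFun, e1, e2, e3, e4, mul_pow, Real.rpow_mul (by positivity),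
        Real.rpow_mul (by positivity), Real.rpow_natCast, Real.rpow_natCast]
    by_contra hc
    rw [e] at hlem
    exact absurd (one_le_pow₀ (not_lt.mp hc)) (not_le.mpr hlem)
  obtain ⟨z, B, hz, hB, hzB, hr⟩ := exists_chernoff ht hq hq1 hlt
  have hz0 : 0 < z := by linarith
  refine ⟨_, by positivity, hr, fun N hN a ha => ?_⟩
  have hN' : 0 < (N : ℝ) := Nat.cast_pos.mpr (Nat.pos_of_ne_zero hN)
  rw [mul_pow, add_pow, Finset.sum_mul]
  refine Finset.sum_le_sum fun ν hν => ?_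
  rw [badWeight]
  split_ifs with hg
  · rw [abs_zero]; positivity
  · have hw := abs_bernsteinWeight_le ha.1 ha.2 N ν
    rw [← ht_def] at hw
    have hqν : q * N ≤ ν := by
      rw [not_le, one_mul, bernsteinNode] at hg
      have : q < ν / N := by rw [hq_def]; linarith
      exact ((lt_div_iff₀ hN').mp this).le
    have h1 : 1 ≤ z ^ ν * B ^ N := by
      calc (1 : ℝ) ≤ (z ^ q * B) ^ N := one_le_pow₀ hzB
        _ = z ^ (q * N) * B ^ N := by
          rw [mul_pow, Real.rpow_mul hz0.le, Real.rpow_natCast]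
        _ ≤ z ^ (ν : ℝ) * B ^ N := by gcongr
        _ = _ := by rw [Real.rpow_natCast]
    calc _ ≤ _ := hw
      _ ≤ (N.choose ν : ℝ) * t ^ ν * (1 + t) ^ (N - ν) * (z ^ ν * B ^ N) :=
        le_mul_of_one_le_right (by positivity) h1
      _ = _ := by rw [mul_pow]; ring

theorem bernsteinWeight_reflect {N ν : ℕ} (h : ν ≤ N) (a : ℝ) :
    bernsteinWeight N (N - ν) a = bernsteinWeight N ν (-a) := by
  rw [bernsteinWeight, bernsteinWeight, Nat.choose_symm h, Nat.sub_sub_self h, sub_neg_eq_add,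
    ← sub_eq_add_neg]
  ring

theorem bernsteinNode_reflect {N ν : ℕ} (hN : N ≠ 0) (h : ν ≤ N) :
    bernsteinNode N (N - ν) = -bernsteinNode N ν := by
  have hN' : (N : ℝ) ≠ 0 := Nat.cast_ne_zero.mpr hN
  rw [bernsteinNode, bernsteinNode, Nat.cast_sub h]
  field_simp
  ring

theorem sum_badWeight_reflect {T : ℝ} {N : ℕ} (hN : N ≠ 0) (a : ℝ) :
    ∑ ν ∈ Finset.range (N + 1), |badWeight (-1) T N ν a| =
      ∑ ν ∈ Finset.range (N + 1), |badWeight 1 T N ν (-a)| := by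
  rw [← Finset.sum_range_reflect]
  refine Finset.sum_congr rfl fun ν hν => ?_
  have h : ν ≤ N := Nat.lt_succ_iff.mp (Finset.mem_range.mp hν)
  rw [Nat.add_sub_cancel, badWeight, badWeight, bernsteinNode_reflect hN h,
    bernsteinWeight_reflect h, neg_mul_neg]

/-- The interval `[1,b]` for `σ = 1` and `[-b,-1]` for `σ = -1`. -/
def signedInterval (σ b : ℝ) : Set ℝ := {a | σ * a ∈ Set.Icc 1 b}

theorem signedInterval_eq {σ : ℝ} (hσ : σ = 1 ∨ σ = -1) (b : ℝ) :
    signedInterval σ b = Set.Icc 1 b ∨ signedInterval σ b = Set.Icc (-b) (-1) := by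
  rcases hσ with rfl | rfl
  · left; ext a; simp [signedInterval]
  · right; ext a
    simp only [signedInterval, Set.mem_ofPred_eq, Set.mem_Icc]
    constructor <;> rintro ⟨h1, h2⟩ <;> constructor <;> linarith

theorem isCompact_signedInterval {σ : ℝ} (hσ : σ = 1 ∨ σ = -1) (b : ℝ) :
    IsCompact (signedInterval σ b) := by
  rcases signedInterval_eq hσ b with h | h <;> rw [h] <;> exact isCompact_Icc

theorem abs_le_of_mem_signedInterval {σ : ℝ} (hσ : σ = 1 ∨ σ = -1) {a b : ℝ}
    (ha : a ∈ signedInterval σ b) : |a| ≤ b := by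
  have h1 := ha.1
  have h2 := ha.2
  rcases hσ with rfl | rfl <;> rw [abs_le] <;> constructor <;> linarith

theorem isNodeScheme_badWeight {σ T b : ℝ} (hσ : σ = 1 ∨ σ = -1) (hT : T ∈ Set.Ico (0 : ℝ) 1)
    (hb : 1 < b) (hb' : b < lemniscateRadius T) :
    IsNodeScheme (badWeight σ T) (signedInterval σ b) False 0 := by
  obtain ⟨r, hr0, hr1, h⟩ := exists_sum_badWeight_le hT hb hb'
  refine isNodeScheme_of_mass (isCompact_signedInterval hσ b)
    (tendsto_pow_atTop_nhds_zero_of_lt_one hr0 hr1) (fun N => pow_le_one₀ hr0 hr1.le)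
    fun N hN a ha => ?_
  have ha' : σ * a ∈ Set.Icc 1 b := ha
  rcases hσ with rfl | rfl
  · rw [one_mul] at ha'
    exact h N hN a ha'
  · rw [neg_one_mul] at ha'
    rw [sum_badWeight_reflect hN]
    exact h N hN _ ha'

/-- All nodes reproduce entire functions and the bad ones contribute nothing in the limit, so the
difference reproduces them too. -/
theorem isNodeScheme_goodWeight {σ T b : ℝ} (hσ : σ = 1 ∨ σ = -1) (hT : T ∈ Set.Ico (0 : ℝ) 1)
    (hb : 1 < b) (hb' : b < lemniscateRadius T) :
    IsNodeScheme (goodWeight σ T) (signedInterval σ b) True 1 := by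
  have := (isNodeScheme_entire hb.le (isCompact_signedInterval hσ b)
    fun a ha => abs_le_of_mem_signedInterval hσ ha).sub (isNodeScheme_badWeight hσ hT hb hb')
  have e : goodWeight σ T = fun N ν a => bernsteinWeight N ν a - badWeight σ T N ν a := by
    funext N ν a
    rw [goodWeight, badWeight]
    split_ifs <;> simp
  rw [e]
  simpa using this

/-! ### Products of node schemes. -/

/-- The product of the functionals `nodeSum (c j) (N j) (a j)`, `j : Fin m`. -/
noncomputable def nodeSumPi {m : ℕ} (c : Fin m → ℕ → ℕ → ℝ → ℝ) (N : Fin m → ℕ) (a : Fin m → ℝ)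
    (f : (Fin m → ℂ) → ℂ) : ℂ :=
  ∑ ν ∈ Fintype.piFinset fun j => Finset.range (N j + 1),
    ((∏ j, c j (N j) (ν j) (a j) : ℝ) : ℂ) * f fun j => (bernsteinNode (N j) (ν j) : ℂ)

theorem sum_piFinset_succ {α : Type*} {m : ℕ} (s : Fin (m + 1) → Finset α)
    (f : (Fin (m + 1) → α) → ℂ) :
    ∑ ν ∈ Fintype.piFinset s, f ν =
      ∑ a ∈ s 0, ∑ ν ∈ Fintype.piFinset fun j => s (Fin.succ j), f (Fin.cons a ν) := by
  rw [← Finset.sum_product']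
  refine Finset.sum_nbij' (fun ν => (ν 0, Fin.tail ν)) (fun p => Fin.cons p.1 p.2) ?_ ?_ ?_ ?_ ?_
  · intro ν hν
    rw [Fintype.mem_piFinset] at hν
    exact Finset.mem_product.mpr ⟨hν 0, Fintype.mem_piFinset.mpr fun j => hν j.succ⟩
  · intro p hp
    obtain ⟨h0, h1⟩ := Finset.mem_product.mp hp
    rw [Fintype.mem_piFinset] at h1 ⊢
    intro j
    refine Fin.cases ?_ (fun j => ?_) j
    · exact h0
    · exact h1 j
  · intro ν _
    exact Fin.cons_self_tail ν
  · intro p _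
    rfl
  · intro ν _
    simp only [Fin.cons_self_tail]

theorem nodeSumPi_succ {m : ℕ} (c : Fin (m + 1) → ℕ → ℕ → ℝ → ℝ) (N : Fin (m + 1) → ℕ)
    (a : Fin (m + 1) → ℝ) (f : (Fin (m + 1) → ℂ) → ℂ) :
    nodeSumPi c N a f = nodeSum (c 0) (N 0) (a 0) fun z =>
      nodeSumPi (fun j => c j.succ) (fun j => N j.succ) (fun j => a j.succ) fun w =>
        f (Fin.cons z w) := by
  rw [nodeSumPi, sum_piFinset_succ, nodeSum]
  refine Finset.sum_congr rfl fun ν _ => ?_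
  rw [nodeSumPi, Finset.mul_sum]
  refine Finset.sum_congr rfl fun ν' _ => ?_
  rw [Fin.prod_univ_succ, Complex.ofReal_mul, mul_assoc]
  simp only [Fin.cons_zero, Fin.cons_succ]
  congr 3
  funext j
  refine Fin.cases ?_ (fun j => ?_) j <;> simp

theorem continuous_finCons {Y : Type*} [TopologicalSpace Y] {m : ℕ} {f : Y → ℂ}
    {g : Y → Fin m → ℂ} (hf : Continuous f) (hg : Continuous g) :
    Continuous fun y => (Fin.cons (f y) (g y) : Fin (m + 1) → ℂ) := by
  refine continuous_pi fun j => ?_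
  refine Fin.cases ?_ (fun j => ?_) j
  · simpa using hf
  · simpa using! (continuous_apply j).comp hg

/-- Convergence of products of node schemes. -/
theorem tendsto_nodeSumPi.{u, v} {ι : Type v} {L : Filter ι} {m : ℕ} :
    ∀ {X : Type u} [PseudoMetricSpace X] {c : Fin m → ℕ → ℕ → ℝ → ℝ} {S : Fin m → Set ℝ}
      {e : Fin m → Prop} {l : Fin m → ℂ}, (∀ j, IsNodeScheme.{u} (c j) (S j) (e j) (l j)) →
      ∀ {G : (Fin m → ℂ) × X → ℂ}, Continuous G →
      (∀ j, e j → ∀ z x, Differentiable ℂ fun w => G (Function.update z j w, x)) →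
      ∀ {n : ι → Fin m → ℕ}, (∀ j, Tendsto (fun i => n i j) L atTop) →
      ∀ {K : Set X}, IsCompact K →
      TendstoUniformlyOn
        (fun i (p : (Fin m → ℝ) × X) => nodeSumPi c (n i) p.1 fun z => G (z, p.2))
        (fun p => (∏ j, l j) * G (fun j => (p.1 j : ℂ), p.2)) L (Set.univ.pi S ×ˢ K) := by
  induction m with
  | zero =>
    intro X _ c S e l _ G _ _ n _ K _
    rw [Metric.tendstoUniformlyOn_iff]
    intro ε hε
    filter_upwards with i p _
    have h (ν : Fin 0 → ℕ) : (fun j => (bernsteinNode (n i j) (ν j) : ℂ)) =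
        fun j => (p.1 j : ℂ) := Subsingleton.elim _ _
    simp only [nodeSumPi, h]
    simpa using hε
  | succ m ih =>
    intro X _ c S e l hc G hG hGe n hn K hK
    have hGc : Continuous fun p : (Fin m → ℂ) × (ℂ × X) =>
        G (Fin.cons p.2.1 p.1, p.2.2) :=
      hG.comp ((continuous_finCons (continuous_fst.comp continuous_snd) continuous_fst).prodMk
        (continuous_snd.comp continuous_snd))
    have hd0 : e 0 → ∀ (w : Fin m → ℂ) x, Differentiable ℂ fun z => G (Fin.cons z w, x) := by
      intro he w x
      have := hGe 0 he (Fin.cons 0 w) x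
      simpa only [Fin.update_cons_zero] using this
    -- The first variable joins the parameters as a complex number: the functional in it is
    -- controlled only by values on a disc, so uniformity there is needed.
    have hih (r : ℝ) : TendstoUniformlyOn
        (fun i (p : (Fin m → ℝ) × (ℂ × X)) =>
          nodeSumPi (fun j => c j.succ) (fun j => n i j.succ) p.1 fun w =>
            G (Fin.cons p.2.1 w, p.2.2))
        (fun p => (∏ j : Fin m, l j.succ) * G (Fin.cons p.2.1 fun j => (p.1 j : ℂ), p.2.2)) L
        (Set.univ.pi (fun j : Fin m => S j.succ) ×ˢ (Metric.closedBall (0 : ℂ) r ×ˢ K)) :=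
      ih (fun j => hc j.succ) hGc
        (fun j he z x => by
          have := hGe j.succ he (Fin.cons x.1 z) x.2
          simpa only [Fin.cons_update] using this)
        (fun j => hn j.succ) ((isCompact_closedBall _ _).prod hK)
    have hcast : Continuous fun p : ℂ × ((Fin m → ℝ) × X) => fun j => (p.2.1 j : ℂ) := by
      fun_prop
    have hK' : IsCompact (Set.univ.pi (fun j : Fin m => S j.succ) ×ˢ K) :=
      (isCompact_univ_pi fun j : Fin m => (hc j.succ).isCompact).prod hK
    -- Now the roles are exchanged: the other coordinates are parameters, and the inner sums are a
    -- converging family of functions of the first variable.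
    have key := (hc 0).tendsto_family (X := (Fin m → ℝ) × X) (hn 0)
      (H := fun i p => nodeSumPi (fun j => c j.succ) (fun j => n i j.succ) p.2.1 fun w =>
        G (Fin.cons p.1 w, p.2.2))
      (G := fun p => (∏ j : Fin m, l j.succ) * G (Fin.cons p.1 fun j => (p.2.1 j : ℂ), p.2.2))
      (continuous_const.mul (hG.comp ((continuous_finCons continuous_fst hcast).prodMk
        (continuous_snd.comp continuous_snd))))
      (fun he p => (hd0 he (fun j => (p.1 j : ℂ)) p.2).const_mul (∏ j : Fin m, l j.succ))
      (fun he i p => by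
        simp only [nodeSumPi]
        exact Differentiable.fun_sum fun ν _ => (hd0 he _ _).const_mul _)
      hK' (fun r => ((hih r).comp fun p : ℂ × ((Fin m → ℝ) × X) => (p.2.1, (p.1, p.2.2))).mono
        fun p hp => ⟨hp.2.1, hp.1, hp.2.2⟩)
    have key' := (key.comp fun p : (Fin (m + 1) → ℝ) × X =>
      (p.1 0, ((fun j : Fin m => p.1 j.succ), p.2))).mono
      (s' := Set.univ.pi S ×ˢ K)
      fun p hp => ⟨hp.1 0 trivial, fun j _ => hp.1 j.succ trivial, hp.2⟩
    refine (key'.congr (.of_forall fun i p _ => ?_)).congr_right fun p _ => ?_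
    · simp only [Function.comp_apply, nodeSumPi_succ]
    · simp only [Function.comp_apply, Fin.prod_univ_succ, mul_assoc]
      congr 4
      funext j
      refine Fin.cases ?_ (fun j => ?_) j <;> simp

/-! ### Splitting by sign patterns and bad coordinates. -/

variable {m : ℕ} {R : Type*}

/-- Taking real parts in the coordinates outside `Jm ∪ Jp` gives a continuous function on all of
`ℂ^m`, the form that products of node schemes require. If `Jm ∪ Jp` is empty, `φ` itself serves. -/
theorem IsPredictable.exists_extension [MetricSpace R] {T : Fin m → ℝ} {φ : (Fin m → ℝ) × R → ℂ}
    (hφ : IsPredictable T φ) {Jm Jp : Finset (Fin m)} (hJ : Disjoint Jm Jp) :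
    ∃ G : (Fin m → ℂ) × R → ℂ, Continuous G ∧
      (∀ j ∈ Jm ∪ Jp, ∀ z x, Differentiable ℂ fun w => G (Function.update z j w, x)) ∧
      ∀ (a : Fin m → ℝ) (x : R), (∀ j ∈ Jm, a j ≤ -T j) → (∀ j ∈ Jp, T j ≤ a j) →
        φ (a, x) = G (fun j => (a j : ℂ), x) := by
  rcases (Jm ∪ Jp).eq_empty_or_nonempty with h | h
  · refine ⟨fun p => φ (fun j => (p.1 j).re, p.2), hφ.continuous.comp (by fun_prop), ?_, ?_⟩
    · simp [h]
    · simp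
  · obtain ⟨F, hF, hFφ⟩ := hφ.extension Jm Jp hJ h
    refine ⟨fun p => (F (fun j => (p.1 j).re, p.2)).1 fun j => p.1 j, ?_, ?_, ?_⟩
    · have h1 : Continuous fun p : (Fin m → ℂ) × R =>
          (F (fun j : {j // j ∉ Jm ∪ Jp} => (p.1 j).re, p.2)).1 :=
        continuous_subtype_val.comp (hF.comp (by fun_prop))
      exact h1.eval (by fun_prop)
    · intro j hj z x
      have e (w : ℂ) : (fun i : {i // i ∉ Jm ∪ Jp} => (Function.update z j w i).re) =
          fun i : {i // i ∉ Jm ∪ Jp} => (z i).re := by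
        funext i
        rw [Function.update_of_ne]
        rintro rfl
        exact i.2 hj
      simp only [e]
      refine (F (fun i => (z i).re, x)).2.comp (differentiable_pi.mpr fun i => ?_)
      by_cases hij : (i : Fin m) = j
      · simp only [hij, Function.update_self]
        exact differentiable_id
      · simp only [Function.update_of_ne hij]
        exact differentiable_const _
    · intro a x hm hp
      rw [hFφ a x hm hp]
      simp

theorem tendstoUniformlyOn_finset_sum {ι κ X : Type*} {l : Filter ι} {s : Set X} (D : Finset κ)
    {F : κ → ι → X → ℂ} {g : κ → X → ℂ} (h : ∀ d ∈ D, TendstoUniformlyOn (F d) (g d) l s) :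
    TendstoUniformlyOn (fun i x => ∑ d ∈ D, F d i x) (fun x => ∑ d ∈ D, g d x) l s := by
  classical
  induction D using Finset.induction_on with
  | empty =>
    simp only [Finset.sum_empty]
    exact tendstoUniformlyOn_of_norm_sub_le tendsto_const_nhds (.of_forall fun _ _ _ => by simp)
  | insert d D hd ih =>
    simp only [Finset.sum_insert hd]
    exact (h d (Finset.mem_insert_self _ _)).add
      (ih fun d' hd' => h d' (Finset.mem_insert_of_mem hd'))

theorem tendstoUniformlyOn_iUnion_of_finite {ι κ X : Type*} [Finite κ] {l : Filter ι}
    {s : κ → Set X} {F : ι → X → ℂ} {g : X → ℂ} (h : ∀ d, TendstoUniformlyOn F g l (s d)) :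
    TendstoUniformlyOn F g l (⋃ d, s d) := by
  rw [Metric.tendstoUniformlyOn_iff]
  intro ε hε
  have := eventually_all.mpr fun d => Metric.tendstoUniformlyOn_iff.mp (h d) ε hε
  filter_upwards [this] with i hi x hx
  obtain ⟨d, hd⟩ := Set.mem_iUnion.mp hx
  exact hi d x hd

/-- The Bernstein weights in a coordinate of sign `σ`, restricted to the bad or good nodes, without
restriction if `σ = 0`. -/
noncomputable def patternWeight (σ : SignType) (T : ℝ) (bad : Prop) [Decidable bad] :
    ℕ → ℕ → ℝ → ℝ :=
  if σ = 0 then bernsteinWeight else if bad then badWeight σ T else goodWeight σ T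

/-- The region of a coordinate of sign `σ`. -/
def patternRegion (σ : SignType) (b : ℝ) : Set ℝ :=
  if σ = 0 then Set.Icc (-1) 1 else signedInterval σ b

theorem coe_eq_one_or_neg_one {σ : SignType} (h : σ ≠ 0) : (σ : ℝ) = 1 ∨ (σ : ℝ) = -1 := by
  rcases σ with _ | _ | _
  · exact absurd rfl h
  · right; simp
  · left; simp

theorem isNodeScheme_patternWeight {T b : ℝ} (hT : T ∈ Set.Ico (0 : ℝ) 1) (hb : 1 < b)
    (hb' : b < lemniscateRadius T) (σ : SignType) (bad : Prop) [Decidable bad] :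
    IsNodeScheme (patternWeight σ T bad) (patternRegion σ b) (σ ≠ 0 ∧ ¬ bad)
      (if σ ≠ 0 ∧ bad then 0 else 1) := by
  rw [patternWeight, patternRegion]
  by_cases hσ : σ = 0
  · simpa [hσ] using isNodeScheme_interval
  · by_cases hbad : bad
    · simpa [hσ, hbad] using isNodeScheme_badWeight (coe_eq_one_or_neg_one hσ) hT hb hb'
    · simpa [hσ, hbad] using isNodeScheme_goodWeight (coe_eq_one_or_neg_one hσ) hT hb hb'

/-- The Bernstein polynomials of a function. -/
noncomputable def bernsteinSum (φ : (Fin m → ℝ) × R → ℂ) (N : Fin m → ℕ+)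
    (p : (Fin m → ℝ) × R) : ℂ :=
  ∑ ν ∈ indices N, (weight N ν p.1 : ℂ) * φ (node N ν, p.2)

/-- The coordinates of nonzero sign for which a node is bad. -/
noncomputable def badCoords (σ : Fin m → SignType) (T y : Fin m → ℝ) : Finset (Fin m) :=
  {j | σ j ≠ 0 ∧ ¬ T j ≤ σ j * y j}

theorem mem_badCoords {σ : Fin m → SignType} {T y : Fin m → ℝ} {j : Fin m} :
    j ∈ badCoords σ T y ↔ σ j ≠ 0 ∧ ¬ T j ≤ σ j * y j :=
  Finset.mem_filter_univ _

theorem prod_patternWeight_badCoords (σ : Fin m → SignType) (T : Fin m → ℝ) (N : Fin m → ℕ+)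
    (ν : Fin m → ℕ) (a : Fin m → ℝ) :
    ∏ j, patternWeight (σ j) (T j) (j ∈ badCoords σ T (node N ν)) (N j) (ν j) (a j) =
      weight N ν a := by
  refine Finset.prod_congr rfl fun j _ => ?_
  change _ = bernsteinWeight (N j) (ν j) (a j)
  rw [patternWeight]
  by_cases hσ : σ j = 0
  · rw [if_pos hσ]
  · rw [if_neg hσ]
    by_cases hg : T j ≤ σ j * bernsteinNode (N j) (ν j)
    · rw [if_neg fun h => (mem_badCoords.mp h).2 hg, goodWeight, if_pos hg]
    · rw [if_pos (mem_badCoords.mpr ⟨hσ, hg⟩), badWeight, if_neg hg]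

/-- Good and bad weights have complementary supports, so a node is seen only by the product
belonging to its own set of bad coordinates. Summing over `D` thus recovers the Bernstein weight. -/
theorem prod_patternWeight_eq_zero {σ : Fin m → SignType} {T : Fin m → ℝ} {N : Fin m → ℕ+}
    {ν : Fin m → ℕ} (a : Fin m → ℝ) {D : Finset (Fin m)} (hD : ∀ j ∈ D, σ j ≠ 0)
    (h : D ≠ badCoords σ T (node N ν)) :
    ∏ j, patternWeight (σ j) (T j) (j ∈ D) (N j) (ν j) (a j) = 0 := by
  obtain ⟨j, hj⟩ : ∃ j, ¬ (j ∈ D ↔ j ∈ badCoords σ T (node N ν)) := by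
    by_contra! hc
    exact h (Finset.ext hc)
  refine Finset.prod_eq_zero (Finset.mem_univ j) ?_
  have hn : node N ν j = bernsteinNode (N j) (ν j) := rfl
  rw [mem_badCoords, hn] at hj
  rw [patternWeight]
  by_cases hjD : j ∈ D
  · have hσ := hD j hjD
    have : T j ≤ σ j * bernsteinNode (N j) (ν j) := by tauto
    simp [hσ, hjD, badWeight, this]
  · have hσ : σ j ≠ 0 := by tauto
    have : ¬ T j ≤ σ j * bernsteinNode (N j) (ν j) := by tauto
    simp [hσ, hjD, goodWeight, this]

theorem tendsto_bernsteinSum_pattern [MetricSpace R] {T : Fin m → ℝ} (hT : ∀ j, T j ∈ Set.Ico (0 : ℝ) 1)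
    {φ : (Fin m → ℝ) × R → ℂ} (hφ : IsPredictable T φ) {b : Fin m → ℝ} (hb : ∀ j, 1 < b j)
    (hb' : ∀ j, b j < lemniscateRadius (T j)) {K : Set R} (hK : IsCompact K)
    (σ : Fin m → SignType) :
    TendstoUniformlyOn (bernsteinSum φ) φ atTop
      (Set.univ.pi (fun j => patternRegion (σ j) (b j)) ×ˢ K) := by
  -- Predictability is used in the good coordinates of nonzero sign only; the bad ones and those of
  -- sign `0` remain real parameters.
  have hdisj (D : Finset (Fin m)) : Disjoint
      (Finset.univ.filter fun j => σ j = -1 ∧ j ∉ D) (Finset.univ.filter fun j => σ j = 1 ∧ j ∉ D) := by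
    rw [Finset.disjoint_filter]
    rintro j _ ⟨h1, _⟩ ⟨h2, _⟩
    rw [h1] at h2
    exact absurd h2 (by decide)
  choose G hG hGd hGφ using fun D => hφ.exists_extension (hdisj D)
  have hsign (j : Fin m) (h : σ j ≠ 0) : σ j = -1 ∨ σ j = 1 := by
    rcases hs : σ j with _ | _ | _
    · exact absurd hs h
    · exact Or.inl rfl
    · exact Or.inr rfl
  have hGφ' (D : Finset (Fin m)) (a : Fin m → ℝ) (x : R)
      (h : ∀ j ∉ D, σ j ≠ 0 → T j ≤ σ j * a j) : φ (a, x) = G D (fun j => (a j : ℂ), x) := by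
    refine hGφ D a x (fun j hj => ?_) fun j hj => ?_
    · obtain ⟨hs, hD⟩ := (Finset.mem_filter_univ _).mp hj
      have := h j hD (by rw [hs]; decide)
      rw [hs] at this
      simp at this
      linarith
    · obtain ⟨hs, hD⟩ := (Finset.mem_filter_univ _).mp hj
      have := h j hD (by rw [hs]; decide)
      rw [hs] at this
      simpa using this
  have key := tendstoUniformlyOn_finset_sum (Finset.univ.filter fun j => σ j ≠ 0).powerset
    fun D _ => tendsto_nodeSumPi (L := atTop)
      (fun j => isNodeScheme_patternWeight (hT j) (hb j) (hb' j) (σ j) (j ∈ D)) (hG D)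
      (fun j hj z x => hGd D j (by
        rw [Finset.mem_union, Finset.mem_filter_univ, Finset.mem_filter_univ]
        have := hsign j hj.1
        tauto) z x)
      (n := fun (N : Fin m → ℕ+) j => (N j : ℕ))
      (fun j => tendsto_PNat_val_atTop_atTop.comp (tendsto_atTop_atTop_of_monotone
        (fun _ _ h => h j) fun c => ⟨fun _ => c, le_rfl⟩)) hK
  refine (key.congr (.of_forall fun N p hp => ?_)).congr_right fun p hp => ?_
  · simp only [nodeSumPi]
    rw [Finset.sum_comm, bernsteinSum]
    refine Finset.sum_congr rfl fun ν _ => ?_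
    -- At a node only its own bad set counts, and there the extension agrees with `φ`.
    rw [Finset.sum_eq_single (badCoords σ T (node N ν))]
    · rw [prod_patternWeight_badCoords, hGφ' (badCoords σ T (node N ν)) (node N ν) p.2]
      · rfl
      · intro j hj hσ
        by_contra hc
        exact hj (mem_badCoords.mpr ⟨hσ, hc⟩)
    · intro D hD hne
      rw [prod_patternWeight_eq_zero _ (fun j hj =>
        (Finset.mem_filter.mp (Finset.mem_powerset.mp hD hj)).2) hne]
      simp
    · intro h
      exfalso
      refine h (Finset.mem_powerset.mpr fun j hj => ?_)
      exact (Finset.mem_filter_univ _).mpr (mem_badCoords.mp hj).1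
  · dsimp only
    -- In the limit every nonempty `D` has a factor `0`. For `D = ∅` the extension equals `φ` at the
    -- point itself, since `σ_j a_j ≥ 1 ≥ T_j` where `σ_j ≠ 0`.
    rw [Finset.sum_eq_single ∅]
    · rw [hGφ' ∅ p.1 p.2]
      · simp
      · intro j _ hσ
        have h1 : p.1 j ∈ patternRegion (σ j) (b j) := hp.1 j trivial
        rw [patternRegion, if_neg hσ] at h1
        exact (hT j).2.le.trans h1.1
    · intro D hD hne
      obtain ⟨j, hj⟩ := Finset.nonempty_iff_ne_empty.mpr hne
      have hσ := (Finset.mem_filter.mp (Finset.mem_powerset.mp hD hj)).2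
      have h0 : ∏ j, (if σ j ≠ 0 ∧ j ∈ D then (0 : ℂ) else 1) = 0 :=
        Finset.prod_eq_zero (Finset.mem_univ j) (if_pos ⟨hσ, hj⟩)
      rw [h0, zero_mul]
    · simp

theorem exists_bound_lt_of_isCompact {X : Type*} [TopologicalSpace X] {K : Set X}
    (hK : IsCompact K) {f : X → ℝ} (hf : Continuous f) {r : ℝ} (hr : 1 < r)
    (h : ∀ x ∈ K, |f x| < r) : ∃ b, 1 < b ∧ b < r ∧ ∀ x ∈ K, |f x| ≤ b := by
  obtain ⟨c, hc1, hcr⟩ := exists_between hr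
  rcases K.eq_empty_or_nonempty with rfl | hne
  · exact ⟨c, hc1, hcr, by simp⟩
  · obtain ⟨x, hx, hmax⟩ := hK.exists_isMaxOn hne (continuous_abs.comp hf).continuousOn
    exact ⟨max c |f x|, lt_max_of_lt_left hc1, max_lt hcr (h x hx),
      fun y hy => (hmax hy).trans (le_max_right _ _)⟩

theorem exists_mem_patternRegion {a b : ℝ} (h : |a| ≤ b) : ∃ σ, a ∈ patternRegion σ b := by
  obtain ⟨h1, h2⟩ := abs_le.mp h
  rcases le_or_gt a (-1) with h3 | h3
  · exact ⟨-1, by simp [patternRegion, signedInterval]; constructor <;> linarith⟩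
  · rcases le_or_gt 1 a with h4 | h4
    · exact ⟨1, by simp [patternRegion, signedInterval]; constructor <;> linarith⟩
    · exact ⟨0, by simp [patternRegion]; constructor <;> linarith⟩

/-- Bernstein polynomials of a predictable function converge on the whole polyinterval. -/
theorem tendsto_bernsteinSum [MetricSpace R] {T : Fin m → ℝ} (hT : ∀ j, T j ∈ Set.Ico (0 : ℝ) 1)
    {φ : (Fin m → ℝ) × R → ℂ} (hφ : IsPredictable T φ) {K : Set ((Fin m → ℝ) × R)}
    (hK : IsCompact K) (h : ∀ p ∈ K, ∀ j, |p.1 j| < lemniscateRadius (T j)) :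
    TendstoUniformlyOn (bernsteinSum φ) φ atTop K := by
  choose b hb hb' hKb using fun j => exists_bound_lt_of_isCompact hK
    (f := fun p => p.1 j) (by fun_prop) (one_lt_lemniscateRadius (hT j)) fun p hp => h p hp j
  refine (tendstoUniformlyOn_iUnion_of_finite fun σ =>
    tendsto_bernsteinSum_pattern hT hφ hb hb' (hK.image continuous_snd) σ).mono fun p hp => ?_
  choose σ hσ using fun j => exists_mem_patternRegion (hKb j p hp)
  exact Set.mem_iUnion.mpr ⟨σ, fun j _ => hσ j, p, hp, rfl⟩

/-! ### Dilations and the pseudo-autosimilarity relation. -/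

/-- Since `T_j ≥ 0` and `c_j ≥ 1`, the half-lines `a_j ≤ -T_j` and `a_j ≥ T_j` are mapped into
themselves; the extensions are composed with a diagonal linear map. -/
theorem IsPredictable.scale [MetricSpace R] {T : Fin m → ℝ} (hT : ∀ j, 0 ≤ T j) {φ : (Fin m → ℝ) × R → ℂ}
    (hφ : IsPredictable T φ) {c : Fin m → ℝ} (hc : ∀ j, 1 ≤ c j) :
    IsPredictable T fun p : (Fin m → ℝ) × R => φ (fun j => c j * p.1 j, p.2) where
  continuous := hφ.continuous.comp (by fun_prop)
  extension := by
    intro Jm Jp hJ hne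
    obtain ⟨F, hF, hFφ⟩ := hφ.extension Jm Jp hJ hne
    let s : C({j // j ∈ Jm ∪ Jp} → ℂ, {j // j ∈ Jm ∪ Jp} → ℂ) :=
      ⟨fun z j => (c j : ℂ) * z j, by fun_prop⟩
    have hs : Differentiable ℂ s := by
      change Differentiable ℂ fun (z : {j // j ∈ Jm ∪ Jp} → ℂ) (j : {j // j ∈ Jm ∪ Jp}) =>
        (c j : ℂ) * z j
      fun_prop
    refine ⟨fun p => ⟨(F (fun j => c j * p.1 j, p.2)).1.comp s,
      (F (fun j => c j * p.1 j, p.2)).2.comp hs⟩, ?_, fun a x hm hp => ?_⟩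
    · refine Continuous.subtype_mk ((ContinuousMap.continuous_precomp s).comp
        (continuous_subtype_val.comp (hF.comp ?_))) _
      fun_prop
    · have := hFφ (fun j => c j * a j) x
        (fun j hj => by nlinarith [hm j hj, hc j, hT j, mul_nonneg (hT j) (sub_nonneg.mpr (hc j))])
        (fun j hj => by nlinarith [hp j hj, hc j, hT j, mul_nonneg (hT j) (sub_nonneg.mpr (hc j))])
      rw [this]
      simp [s]

theorem IsPredictable.dilate [MetricSpace R] {T ρ : Fin m → ℝ} (hT : ∀ j, 0 ≤ T j) {φ : (Fin m → ℝ) × R → ℂ}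
    (hφ : IsPredictable T φ) (hρ : ∀ j, 1 ≤ ρ j) (n : ℕ) :
    IsPredictable T fun p : (Fin m → ℝ) × R => φ (Supershift.dilate ρ n p.1, p.2) :=
  hφ.scale hT (c := fun j => ρ j ^ (n : ℤ)) fun j => one_le_zpow₀ (hρ j) (Int.natCast_nonneg n)

theorem dilate_dilate {ρ : Fin m → ℝ} (hρ : ∀ j, ρ j ≠ 0) (n k : ℤ) (a : Fin m → ℝ) :
    dilate ρ n (dilate ρ k a) = dilate ρ (n + k) a := by
  funext j
  rw [dilate, dilate, dilate, zpow_add₀ (hρ j), mul_assoc]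

theorem dilate_zero (ρ a : Fin m → ℝ) : dilate ρ 0 a = a := by
  funext j
  simp [dilate]

theorem continuous_dilate (ρ : Fin m → ℝ) (n : ℤ) : Continuous (dilate ρ n) := by
  unfold dilate
  fun_prop

theorem mem_box_iff {T ρ : Fin m → ℝ} {k : ℕ} {p : (Fin m → ℝ) × R} :
    p ∈ box R T ρ k ↔ ∀ j, |p.1 j| < ρ j ^ k * lemniscateRadius (T j) := by
  simp only [box, Set.mem_ofPred_eq, Set.mem_Ioo, abs_lt]

theorem dilate_neg_mem_box {T ρ : Fin m → ℝ} (hρ : ∀ j, 0 < ρ j) {n k : ℕ}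
    {p : (Fin m → ℝ) × R} (hp : p ∈ box R T ρ (n + k)) :
    (dilate ρ (-(k : ℤ)) p.1, p.2) ∈ box R T ρ n := by
  rw [mem_box_iff] at hp ⊢
  intro j
  have h := hp j
  have hk : 0 < ρ j ^ k := pow_pos (hρ j) k
  change |dilate ρ (-(k : ℤ)) p.1 j| < _
  rw [dilate, zpow_neg, zpow_natCast, abs_mul, abs_of_pos (inv_pos.mpr hk), inv_mul_lt_iff₀ hk]
  calc _ < _ := h
    _ = _ := by ring

/-- The Bernstein pseudo-autosimilarity relation. -/
theorem tendstoOnCompacts_bernsteinSum_dilate [MetricSpace R] {T ρ : Fin m → ℝ}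
    (hT : ∀ j, T j ∈ Set.Ico (0 : ℝ) 1) (hρ : ∀ j, 1 < ρ j) {φ : (Fin m → ℝ) × R → ℂ}
    (hφ : IsPredictable T φ) (k : ℕ) :
    TendstoOnCompacts (fun (N : Fin m → ℕ+) (p : (Fin m → ℝ) × R) =>
        ∑ ν ∈ indices N, (weight N ν (dilate ρ (-(k : ℤ)) p.1) : ℂ) *
          φ (dilate ρ k (node N ν), p.2))
      φ atTop (box R T ρ k) := by
  intro K hK hKc
  have hc : Continuous fun p : (Fin m → ℝ) × R => (dilate ρ (-(k : ℤ)) p.1, p.2) :=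
    ((continuous_dilate ρ _).comp continuous_fst).prodMk continuous_snd
  have hφ' := hφ.dilate (fun j => (hT j).1) (fun j => (hρ j).le) k
  have key := ((tendsto_bernsteinSum hT hφ' (hKc.image hc) (by
    rintro _ ⟨p, hp, rfl⟩ j
    have hp' : p ∈ box R T ρ (0 + k) := by rw [zero_add]; exact hK hp
    have := mem_box_iff.mp (dilate_neg_mem_box (fun j => by linarith [hρ j]) hp') j
    rwa [pow_zero, one_mul] at this)).comp
      fun p : (Fin m → ℝ) × R => (dilate ρ (-(k : ℤ)) p.1, p.2)).mono
      (Set.subset_preimage_image _ K)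
  refine key.congr_right fun p _ => ?_
  rw [Function.comp_apply, dilate_dilate (fun j => by linarith [hρ j]), add_neg_cancel,
    dilate_zero]

/-! ### Iterated limits of nested Bernstein sums. -/

theorem IsIteratedLimit.comp {ι X Y : Type*} [TopologicalSpace X] [TopologicalSpace Y]
    {l : Filter ι} {U : Set X} {V : Set Y} {h : Y → X} (hc : Continuous h)
    (hUV : Set.MapsTo h V U) {n : ℕ} {F : (Fin n → ι) → X → ℂ} {g : X → ℂ}
    (hF : IsIteratedLimit l U n F g) :
    IsIteratedLimit l V n (fun N y => F N (h y)) fun y => g (h y) := by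
  induction n with
  | zero => exact fun y hy => hF (hUV hy)
  | succ n ih =>
    obtain ⟨G, hG, hGg⟩ := hF
    refine ⟨fun M y => G M (h y), fun M K hK hKc => ?_, ih hGg⟩
    exact ((hG M (h '' K) (Set.image_subset_iff.mpr fun y hy => hUV (hK hy))
      (hKc.image hc)).comp h).mono (Set.subset_preimage_image _ K)

theorem tendstoUniformlyOn_continuous_mul {ι X : Type*} [TopologicalSpace X] {l : Filter ι}
    {K : Set X} (hK : IsCompact K) {c : X → ℂ} (hc : Continuous c) {F : ι → X → ℂ} {g : X → ℂ}
    (h : TendstoUniformlyOn F g l K) :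
    TendstoUniformlyOn (fun i x => c x * F i x) (fun x => c x * g x) l K := by
  obtain ⟨C, hC⟩ := hK.exists_bound_of_continuousOn hc.continuousOn
  rw [Metric.tendstoUniformlyOn_iff] at h ⊢
  intro ε hε
  have hC' : 0 < |C| + 1 := by positivity
  filter_upwards [h (ε / (|C| + 1)) (by positivity)] with i hi x hx
  have h1 := hi x hx
  rw [lt_div_iff₀ hC'] at h1
  rw [dist_eq_norm, ← mul_sub, norm_mul, ← dist_eq_norm]
  have h2 : ‖c x‖ ≤ |C| + 1 := (hC x hx).trans ((le_abs_self C).trans (by linarith))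
  calc _ ≤ (|C| + 1) * dist (g x) (F i x) := mul_le_mul_of_nonneg_right h2 dist_nonneg
    _ < ε := by rwa [mul_comm]

theorem continuous_weight (N : Fin m → ℕ+) (ν : Fin m → ℕ) : Continuous (weight N ν) := by
  unfold weight
  fun_prop

/-- The coefficient of the outer sums of the nested Bernstein sum. -/
noncomputable def nestedWeight (ρ : Fin m → ℝ) (k : ℕ) (N : Fin (k + 1) → Fin m → ℕ+)
    (ν : Fin (k + 1) → Fin m → ℕ) (a : Fin m → ℝ) : ℝ :=
  weight (N (Fin.last k)) (ν (Fin.last k)) a *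
    ∏ κ : Fin k, weight (N κ.castSucc) (ν κ.castSucc) (dilate ρ 1 (node (N κ.succ) (ν κ.succ)))

theorem nestedWeight_cons (ρ : Fin m → ℝ) (k : ℕ) (N₀ : Fin m → ℕ+) (ν₀ : Fin m → ℕ)
    (N : Fin (k + 1) → Fin m → ℕ+) (ν : Fin (k + 1) → Fin m → ℕ) (a : Fin m → ℝ) :
    nestedWeight ρ (k + 1) (Fin.cons N₀ N : Fin (k + 2) → Fin m → ℕ+)
      (Fin.cons ν₀ ν : Fin (k + 2) → Fin m → ℕ) a =
      nestedWeight ρ k N ν a * weight N₀ ν₀ (dilate ρ 1 (node (N 0) (ν 0))) := by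
  rw [nestedWeight, nestedWeight, Fin.prod_univ_succ, ← Fin.succ_last]
  simp only [Fin.castSucc_zero, Fin.cons_zero, Fin.cons_succ, Fin.castSucc_succ]
  ring

/-- The index `ν_0` meets the others only through `ν_1`, so the innermost sum is a Bernstein
polynomial of `φ` at the dilated node of `N_1`. -/
theorem nestedBernstein_succ (φ : (Fin m → ℝ) × R → ℂ) (ρ : Fin m → ℝ) (k : ℕ)
    (N₀ : Fin m → ℕ+) (N : Fin (k + 1) → Fin m → ℕ+) (p : (Fin m → ℝ) × R) :
    nestedBernstein φ ρ (k + 1) (Fin.cons N₀ N) p =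
      ∑ ν ∈ Fintype.piFinset fun κ => indices (N κ),
        (nestedWeight ρ k N ν (dilate ρ (-((k + 1 : ℕ) : ℤ)) p.1) : ℂ) *
          bernsteinSum φ N₀ (dilate ρ 1 (node (N 0) (ν 0)), p.2) := by
  change ∑ ν ∈ Fintype.piFinset _, (nestedWeight ρ (k + 1) (Fin.cons N₀ N) ν
    (dilate ρ (-((k + 1 : ℕ) : ℤ)) p.1) : ℂ) * _ = _
  rw [sum_piFinset_succ, Finset.sum_comm]
  refine Finset.sum_congr rfl fun ν _ => ?_
  rw [bernsteinSum, Finset.mul_sum]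
  refine Finset.sum_congr rfl fun ν₀ _ => ?_
  rw [nestedWeight_cons, Complex.ofReal_mul, mul_assoc]
  simp only [Fin.cons_zero]

theorem nestedBernstein_zero (φ : (Fin m → ℝ) × R → ℂ) (ρ : Fin m → ℝ)
    (N : Fin 1 → Fin m → ℕ+) (p : (Fin m → ℝ) × R) :
    nestedBernstein φ ρ 0 N p = bernsteinSum φ (N 0) p := by
  rw [nestedBernstein, sum_piFinset_succ, bernsteinSum]
  refine Finset.sum_congr rfl fun ν _ => ?_
  rw [Fintype.piFinset_of_isEmpty]
  simp [dilate_zero]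

theorem abs_node_le_one (N : Fin m → ℕ+) {ν : Fin m → ℕ} (hν : ν ∈ indices N) (j : Fin m) :
    |node N ν j| ≤ 1 :=
  abs_le.mpr (bernsteinNode_mem (Fintype.mem_piFinset.mp hν j))

/-- The induction on `k` must range over all `φ`: after the limit in `N_0` there remains a nested
sum with one level less for `φ ∘ ρ`, at the point `ρ^(-1)·a`. -/
theorem isIteratedLimit_nestedBernstein [MetricSpace R] {T ρ : Fin m → ℝ}
    (hT : ∀ j, T j ∈ Set.Ico (0 : ℝ) 1)
    (hρ : ∀ j, 1 < ρ j ∧ ρ j < lemniscateRadius (T j)) (k : ℕ) :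
    ∀ {φ : (Fin m → ℝ) × R → ℂ}, IsPredictable T φ →
      IsIteratedLimit (atTop : Filter (Fin m → ℕ+)) (box R T ρ k) (k + 1)
        (nestedBernstein φ ρ k) φ := by
  have hρ0 : ∀ j, ρ j ≠ 0 := fun j => by linarith [hρ j]
  induction k with
  | zero =>
    intro φ hφ
    refine ⟨fun _ => φ, fun M K hK hKc => ?_, fun _ _ => rfl⟩
    have := tendsto_bernsteinSum hT hφ hKc fun p hp j => by
      simpa using mem_box_iff.mp (hK hp) j
    refine this.congr (.of_forall fun N p _ => ?_)
    rw [nestedBernstein_zero, Fin.cons_zero]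
  | succ k ih =>
    intro φ hφ
    have hφ' := hφ.dilate (fun j => (hT j).1) (fun j => (hρ j).1.le) 1
    have hc : Continuous fun p : (Fin m → ℝ) × R => (dilate ρ (-((1 : ℕ) : ℤ)) p.1, p.2) :=
      ((continuous_dilate ρ _).comp continuous_fst).prodMk continuous_snd
    refine ⟨fun M p => nestedBernstein (fun p => φ (dilate ρ ((1 : ℕ) : ℤ) p.1, p.2)) ρ k M
      (dilate ρ (-((1 : ℕ) : ℤ)) p.1, p.2), fun M K hK hKc => ?_, ?_⟩
    -- The outer sums are finite and `a` enters only through their continuous coefficients. The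
    -- Bernstein polynomials are evaluated at `ρ·y` with `|ρ_j y_j| ≤ ρ_j < r(T_j)`, which is where
    -- the upper bound on `ρ_j` is needed.
    · have key := tendstoUniformlyOn_finset_sum (l := atTop) (s := K)
        (Fintype.piFinset fun κ => indices (M κ)) fun ν hν =>
        tendstoUniformlyOn_continuous_mul hKc
          (c := fun p => (nestedWeight ρ k M ν (dilate ρ (-((k + 1 : ℕ) : ℤ)) p.1) : ℂ))
          (by
            refine Complex.continuous_ofReal.comp (Continuous.mul ?_ continuous_const)
            exact (continuous_weight _ _).comp ((continuous_dilate _ _).comp continuous_fst))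
          (((tendsto_bernsteinSum hT hφ ((hKc.image continuous_snd).image
            (f := fun x => (dilate ρ 1 (node (M 0) (ν 0)), x)) (by fun_prop)) (by
              rintro _ ⟨x, _, rfl⟩ j
              have h1 := abs_node_le_one (M 0) (Fintype.mem_piFinset.mp hν 0) j
              have h2 : |ρ j| = ρ j := abs_of_pos (by linarith [hρ j])
              simp only [dilate, zpow_one]
              rw [abs_mul, h2]
              nlinarith [hρ j])).comp
                fun p : (Fin m → ℝ) × R => (dilate ρ 1 (node (M 0) (ν 0)), p.2)).mono
                  fun p hp => ⟨p.2, ⟨p, hp, rfl⟩, rfl⟩)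
      refine (key.congr (.of_forall fun N p _ => ?_)).congr_right fun p _ => ?_
      · exact (nestedBernstein_succ φ ρ k N M p).symm
      · have e : dilate ρ (-((k + 1 : ℕ) : ℤ)) p.1 =
            dilate ρ (-(k : ℤ)) (dilate ρ (-((1 : ℕ) : ℤ)) p.1) := by
          rw [dilate_dilate hρ0]
          congr 1
          push_cast
          ring
        simp only [e]
        rfl
    · have := (ih hφ').comp hc fun p hp =>
        dilate_neg_mem_box (fun j => by linarith [hρ j]) (n := k) (k := 1) hp
      simpa only [dilate_dilate hρ0, add_neg_cancel, dilate_zero] using this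

end Supershift

/-- In `Fin m → ℕ+` the filter `atTop` is the filter `min N → ∞`. The first conjunct is the
iterated limit formula, the second the Bernstein `ρ`-pseudo-autosimilarity relation. -/
theorem theorem4p5 {m : ℕ} (hm : 1 ≤ m) {R : Type*} [MetricSpace R]
    (T : Fin m → ℝ) (hT : ∀ j, T j ∈ Set.Ico (0 : ℝ) 1)
    (φ : (Fin m → ℝ) × R → ℂ) (hφ : Supershift.IsPredictable T φ)
    (ρ : Fin m → ℝ) (hρ : ∀ j, 1 < ρ j ∧ ρ j < Supershift.lemniscateRadius (T j)) (k : ℕ) :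
    Supershift.IsIteratedLimit (Filter.atTop : Filter (Fin m → ℕ+)) (Supershift.box R T ρ k)
      (k + 1) (Supershift.nestedBernstein φ ρ k) φ ∧
    Supershift.TendstoOnCompacts
      (fun (N : Fin m → ℕ+) (p : (Fin m → ℝ) × R) =>
        ∑ ν ∈ Supershift.indices N,
          (Supershift.weight N ν (Supershift.dilate ρ (-(k : ℤ)) p.1) : ℂ) *
            φ (Supershift.dilate ρ k (Supershift.node N ν), p.2))
      φ Filter.atTop (Supershift.box R T ρ k) := by
  exact ⟨Supershift.isIteratedLimit_nestedBernstein hT hρ k hφ,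
    Supershift.tendstoOnCompacts_bernsteinSum_dilate hT (fun j => (hρ j).1) hφ k⟩
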